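/- Let $H=\mathbb{C}((z^{-1}))$ be the space of formal Laurent series $\sum_{k\le N}a_kz^k$, let $H_+=\mathbb{C}[z]$ and let $H_-$ be the space of series with only negative powers of $z$. The order of $w\ne 0$ is the highest power of $z$ occurring in $w$, and $S_W\subset\mathbb{Z}$ denotes the set of orders of the nonzero elements of a subspace $W\subset H$. Let $\mathrm{Gr}$ be the set of closed subspaces of $H$ whose projection to $H_+$ along $H_-$ is Fredholm, $\mathrm{Gr}^{(2)}=\{V\in\mathrm{Gr}: z^2V\subset V\}$, and for $n\ge 0$ let $\Sigma^{(2)}_{2n}=\{V\in \mathrm{Gr}^{(2)}: S_V=S_{2n}\}$ with $S_{2n}=\{-2n,-2n+2,\dots,0,2,\dots,2n,2n+1,2n+2,\dots\}$. Put $\lambda=z^2$. Let $W^{(2)}_{2n}$ be the set of all subspaces $W\subset H$ spanned by series $$p_0=1+\sum_{k\ge1}\frac{H^0_k}{z^k},\quad p_{2m}=z^{2m}p_0\ (m\ge 1),\quad p_{2m+1}=z^{2m+1}+\sum_{\substack{1\le k\le 2n-1\\ k\ \mathrm{odd}}}H^{2m+1}_{-k}z^k+\sum_{k\ge1}\frac{H^{2m+1}_k}{z^k}\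 (m\ge n),$$ such that every product $p_ip_j$ is a finite linear combination, with constant coefficients, of the $p_l$. There are polynomials $U_0,\dots,U_{2n}$ with complex coefficients (depending only on $n$) in the variables $H^{2n+1}_{2k+1}$, $k\ge -n$ (where $H^{2n+1}_{2k+1}$ is the coefficient of $z^{-(2k+1)}$ in $p_{2n+1}$), such that for every $W\in W^{(2)}_{2n}$, with $u_m$ the value of $U_m$ and $f(\lambda)=\lambda^{2n+1}+\sum_{m=0}^{2n}u_m\lambda^m$, the following hold. 1. $W$ is contained in a point $V$ of $\Sigma^{(2)}_{2n}$ with $V=W+(V\cap H_-)$. 2. $W$ is closed under multiplication and contains $1$; $p_{2m}=\lambda^m$ for all $m\geq 0$, and $\lambda^m$ ($m\ge 0$), $p_{2n+1},p_{2n+3},\dots$ is a basis of $W$. As an algebra, $W\cong\mathbb{C}[\lambda,p_{2n+1}]/(p_{2n+1}^2-f(\lambda))$, where the generators correspond to the series $\lambda$ and $p_{2n+1}$. 3. For $m\ge n+1$ there are monic polynomials $\alpha_m$ of degree $m-n$ with $p_{2m+1}=\alpha_m(\lambda)p_{2n+1}$, and the ideal of all polynomial relations between $\lambda,p_{2n+1},p_{2n+3},\dots$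 is generated by $p_{2n+1}^2-f(\lambda)$ and $p_{2m+1}-\alpha_m(\lambda)p_{2n+1}$, $m\ge n+1$. For every $l\ge n+1$ the ideal of relations between $\lambda$ and $p_{2l+1}$ is generated by $p_{2l+1}^2-\alpha_l(\lambda)^2f(\lambda)$, where $\alpha_l^2f$ has degree $2l+1$; the curve $p_{2l+1}^2=\alpha_l(\lambda)^2f(\lambda)$ is irreducible and birational to the base curve $p_{2n+1}^2=f(\lambda)$. If $f$ is squarefree (the generic case), then the base curve and all curves $p_{2l+1}^2=\alpha_l(\lambda)^2f(\lambda)$, $l\ge n+1$, of the tower have geometric genus $n$. 4. $\mathrm{Codim}(W)=n$, where $\mathrm{Codim}(W)=\mathrm{card}(\mathbb{N}\setminus S_W)$, $\mathbb N=\{0,1,2,\dots\}$; moreover the image of the projection $W\to H_+$ has codimension $n$. 5. $\mathrm{index}(\overline{\partial}_W)=-n$. Here $\widetilde W=\{v\in H:\oint \frac{dz}{2\pi i z}\,v u=0\ \ \forall u\in W\}$ (formal residue) and $\mathrm{index}(\overline{\partial}_W)=\dim(W\cap H_-)-\dim(\widetilde W\cap H_-)$, both spaces being finite-dimensional. Equivalently,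 $\mathrm{card}(S_W\setminus\mathbb{N})-\mathrm{card}(S_{\widetilde W}\setminus\mathbb{N})=-n$, both sets being finite. Finally, for every $(u_0,\dots,u_{2n})\in\mathbb{C}^{2n+1}$ there is exactly one $W\in W^{(2)}_{2n}$ with $p_{2n+1}^2=\lambda^{2n+1}+\sum_{m=0}^{2n}u_m\lambda^m$. -/

import Mathlib

open scoped Polynomial

noncomputable section

namespace BirkhoffGr

/-! ### Formal Laurent series and the Sato Grassmannian -/

/-- The space `H` of formal Laurent series `∑_{k ≤ N} a_k z ^ k` (finitely many positive powers
of `z`). They are realised as Laurent series in the local parameter `z⁻¹` at infinity, so the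
coefficient of `z ^ k` is the coefficient of `(z⁻¹) ^ (-k)`. -/
def H : Type := LaurentSeries ℂ

instance : Field H := inferInstanceAs (Field (HahnSeries ℤ ℂ))

/-- The usual coefficientwise structure of a `ℂ`-algebra. -/
instance : Algebra ℂ H := (HahnSeries.instAlgebra : Algebra ℂ (HahnSeries ℤ ℂ))

/-- The coefficient of `z ^ k`. -/
def zcoeff (f : H) (k : ℤ) : ℂ := HahnSeries.coeff (Γ := ℤ) (R := ℂ) f (-k)

/-- The monomial `z ^ k`. -/
def zpow (k : ℤ) : H := (HahnSeries.single (-k) (1 : ℂ) : HahnSeries ℤ ℂ)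

theorem zcoeff_zero (k : ℤ) : zcoeff 0 k = 0 := rfl

theorem zcoeff_add (f g : H) (k : ℤ) : zcoeff (f + g) k = zcoeff f k + zcoeff g k := rfl

theorem zcoeff_smul (c : ℂ) (f : H) (k : ℤ) : zcoeff (c • f) k = c * zcoeff f k := rfl

/-- `lam = z ^ 2`. -/
def lam : H := zpow 2

/-- `f` has order `s`: the highest power of `z` that occurs in `f` is `z ^ s`. -/
def HasOrder (f : H) (s : ℤ) : Prop := zcoeff f s ≠ 0 ∧ ∀ k : ℤ, s < k → zcoeff f k = 0

/-- The set `S_W` of orders of elements of `W`. -/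
def orders (W : Submodule ℂ H) : Set ℤ := {s | ∃ w ∈ W, HasOrder w s}

/-- `H_-`: the series with only negative powers of `z`. It is the complement of
`H_+ = ℂ[z]` in `H`. -/
def Hminus : Submodule ℂ H where
  carrier := {f | ∀ k : ℤ, 0 ≤ k → zcoeff f k = 0}
  add_mem' := fun ha hb k hk => by rw [zcoeff_add, ha k hk, hb k hk, add_zero]
  zero_mem' := fun k _ => zcoeff_zero k
  smul_mem' := fun c _ ha k hk => by rw [zcoeff_smul, ha k hk, mul_zero]

/-- The projection `W → H_+` along `H_-`, where `H_+` is identified with `H / H_-`. -/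
def projPlus (W : Submodule ℂ H) : W →ₗ[ℂ] (H ⧸ Hminus) := Hminus.mkQ ∘ₗ W.subtype

/-- `W` is closed in the topology of formal Laurent series (neighbourhoods of `0` are given by
the series of order at most `N`, `N → -∞`). -/
def IsClosedSubspace (W : Submodule ℂ H) : Prop :=
  ∀ f : H, (∀ N : ℤ, ∃ w ∈ W, ∀ k : ℤ, N < k → zcoeff (f - w) k = 0) → f ∈ W

/-- The Sato Grassmannian: closed subspaces whose projection to `H_+` is Fredholm. -/
def Gr : Set (Submodule ℂ H) :=
  {W | IsClosedSubspace W ∧ FiniteDimensional ℂ (LinearMap.ker (projPlus W)) ∧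
    FiniteDimensional ℂ ((H ⧸ Hminus) ⧸ LinearMap.range (projPlus W))}

/-- `Gr⁽²⁾`: the points `W` of the Grassmannian with `z ^ 2 • W ⊆ W`. -/
def Gr2 : Set (Submodule ℂ H) := {W | W ∈ Gr ∧ ∀ w ∈ W, lam * w ∈ W}

/-- `S_{2n} = {-2n, -2n+2, …, 0, 2, …, 2n, 2n+1, 2n+2, …}`. -/
def S2 (n : ℕ) : Set ℤ := {s | (Even s ∧ -(2 * n : ℤ) ≤ s) ∨ (2 * n + 1 : ℤ) ≤ s}

/-- The Birkhoff stratum `Σ⁽²⁾_{2n}` of `Gr⁽²⁾`. -/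
def stratum2 (n : ℕ) : Set (Submodule ℂ H) := {W | W ∈ Gr2 ∧ orders W = S2 n}

/-! ### The subset `W⁽²⁾_{2n}` -/

/-- The nonnegative elements `0, 2, …, 2n, 2n+1, 2n+2, …` of `S_{2n}`. -/
def posOrders (n : ℕ) : Set ℕ := {i | Even i ∨ 2 * n + 1 ≤ i}

/-- The elements `p_i`, `i ∈ posOrders n`, of the canonical basis of the stratum:
`p_0 = 1 + ∑_{k ≥ 1} H^0_k z ^ (-k)`, `p_{2m} = z ^ (2m) p_0`, and, for `m ≥ n`,
`p_{2m+1} = z ^ (2m+1) + ∑_{k odd, 1 ≤ k ≤ 2n-1} H^{2m+1}_{-k} z ^ k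
  + ∑_{k ≥ 1} H^{2m+1}_k z ^ (-k)`.
The values `p_i` at the gaps `i = 1, 3, …, 2n-1` play no role. -/
structure IsCanonical (n : ℕ) (p : ℕ → H) : Prop where
  zero_lead : zcoeff (p 0) 0 = 1
  zero_pos : ∀ k : ℤ, 0 < k → zcoeff (p 0) k = 0
  even_eq : ∀ m : ℕ, p (2 * m) = zpow (2 * m) * p 0
  odd_lead : ∀ m : ℕ, n ≤ m → zcoeff (p (2 * m + 1)) (2 * m + 1) = 1
  odd_pos : ∀ m : ℕ, n ≤ m → ∀ k : ℤ, 0 ≤ k → k ≠ 2 * m + 1 →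
    (Even k ∨ (2 * n + 1 : ℤ) ≤ k) → zcoeff (p (2 * m + 1)) k = 0

/-- The span of the `p_i`, `i ∈ posOrders n`. -/
def wSpan (n : ℕ) (p : ℕ → H) : Submodule ℂ H := Submodule.span ℂ (p '' posOrders n)

/-- A canonical family with `p_i p_j = ∑_l C^l_{ij} p_l` (finite sums, constant `C^l_{ij}`). -/
def IsMultCanonical (n : ℕ) (p : ℕ → H) : Prop :=
  IsCanonical n p ∧ ∀ i ∈ posOrders n, ∀ j ∈ posOrders n, p i * p j ∈ wSpan n p

/-- `W⁽²⁾_{2n}`. -/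
def W2 (n : ℕ) : Set (Submodule ℂ H) := {W | ∃ p : ℕ → H, IsMultCanonical n p ∧ W = wSpan n p}

/-- `λ ^ (2n+1) + ∑_{m=0}^{2n} u_m λ ^ m`. -/
def basePoly (n : ℕ) (u : Fin (2 * n + 1) → ℂ) : ℂ[X] :=
  Polynomial.X ^ (2 * n + 1) +
    ∑ m : Fin (2 * n + 1), Polynomial.C (u m) * Polynomial.X ^ (m : ℕ)

/-! ### The curves `p ^ 2 = g(λ)` and their genus -/

/-- The polynomial `p ^ 2 - g(λ)` in the variables `λ = X 0`, `p = X 1`. -/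
def curveEq (g : ℂ[X]) : MvPolynomial (Fin 2) ℂ :=
  MvPolynomial.X 1 ^ 2 - Polynomial.aeval (MvPolynomial.X 0) g

/-- The coordinate ring `ℂ[λ, p] / (p ^ 2 - g(λ))`. -/
abbrev CurveRing (g : ℂ[X]) : Type := MvPolynomial (Fin 2) ℂ ⧸ Ideal.span {curveEq g}

/-- The everywhere regular differentials of a function field `F` over `ℂ`: those `ω` that lie,
for every valuation ring `A` of `F` over `ℂ` (that is, at every place), in the `A`-module
`A · dA` of differentials regular at that place. -/
def regularDifferentials (F : Type) [Field F] [Algebra ℂ F] :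
    Submodule ℂ (KaehlerDifferential ℂ F) where
  carrier := {ω | ∀ A : ValuationSubring F, (∀ c : ℂ, algebraMap ℂ F c ∈ A) →
    ω ∈ Submodule.span A ((KaehlerDifferential.D ℂ F) '' (A : Set F))}
  add_mem' := fun ha hb A hA => Submodule.add_mem _ (ha A hA) (hb A hA)
  zero_mem' := fun A _ => Submodule.zero_mem _
  smul_mem' := by
    intro c ω hω A hA
    have h := Submodule.smul_mem _ (⟨algebraMap ℂ F c, hA c⟩ : A) (hω A hA)
    have e : (⟨algebraMap ℂ F c, hA c⟩ : A) • ω = c • ω := by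
      change (algebraMap ℂ F c) • ω = c • ω
      exact algebraMap_smul F c ω
    rwa [e] at h

/-- The irreducible curve `p ^ 2 = g(λ)` has (geometric) genus `k`: the space of everywhere
regular differentials on its smooth projective model has dimension `k`. -/
def CurveHasGenus (g : ℂ[X]) (k : ℕ) : Prop :=
  ∃ _ : IsDomain (CurveRing g),
    Module.rank ℂ (regularDifferentials (FractionRing (CurveRing g))) = k

/-! ### The tower of curves -/

/-- The variables `λ` (`none`) and `p_{2m+1}`, `m = n + j` (`some j`). -/
abbrev TowerVar : Type := Option ℕ

/-- The point `(λ, p_{2n+1}, p_{2n+3}, …)` with coordinates in `H`. -/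
def towerPoint (n : ℕ) (p : ℕ → H) : TowerVar → H
  | none => lam
  | some j => p (2 * (n + j) + 1)

/-- The ideal `I⁽²⁾` generated by `p_{2n+1} ^ 2 - f(λ)` and by
`l_m = p_{2m+1} - α_m(λ) p_{2n+1}`, `m ≥ n + 1`. -/
def towerIdeal (n : ℕ) (f : ℂ[X]) (α : ℕ → ℂ[X]) : Ideal (MvPolynomial TowerVar ℂ) :=
  Ideal.span
    (insert
      (MvPolynomial.X (some 0) ^ 2 - Polynomial.aeval (MvPolynomial.X none) f)
      {l | ∃ j : ℕ, 1 ≤ j ∧ l = MvPolynomial.X (some j) -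
        Polynomial.aeval (MvPolynomial.X none) (α (n + j)) * MvPolynomial.X (some 0)})

/-! ### Codimension and index -/

/-- `Codim W = card (ℕ - S_W)`. -/
def codim (W : Submodule ℂ H) : ℕ∞ := {k : ℕ | (k : ℤ) ∉ orders W}.encard

/-- The dual of `W`: the formal series `v` with `∮ v u dz / (2πi z) = 0` for all `u ∈ W`. -/
def dualSpace (W : Submodule ℂ H) : Submodule ℂ H where
  carrier := {v | ∀ u ∈ W, zcoeff (v * u) 0 = 0}
  add_mem' := fun ha hb u hu => by rw [add_mul, zcoeff_add, ha u hu, hb u hu, add_zero]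
  zero_mem' := fun u _ => by rw [zero_mul, zcoeff_zero]
  smul_mem' := fun c _ ha u hu => by rw [smul_mul_assoc, zcoeff_smul, ha u hu, mul_zero]

/-- The kernel of `∂̄_W`: the elements of `W` that extend holomorphically to the disc around
`z = ∞`, vanishing there, that is, the elements of `W` of negative order. -/
def dbarKer (W : Submodule ℂ H) : Submodule ℂ H := W ⊓ Hminus

/-- The cokernel of `∂̄_W`, that is, the kernel of the `∂̄` operator for the dual of `W`
(the formal adjoint up to sign). -/
def dbarCoker (W : Submodule ℂ H) : Submodule ℂ H := dbarKer (dualSpace W)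

/-- `index ∂̄_W = dim ker ∂̄_W - dim coker ∂̄_W`. -/
def dbarIndex (W : Submodule ℂ H) : ℤ :=
  (Module.finrank ℂ (dbarKer W) : ℤ) - (Module.finrank ℂ (dbarCoker W) : ℤ)

/-- The nonnegative integers `ℕ` inside `ℤ`. -/
def natInt : Set ℤ := {s | 0 ≤ s}

end BirkhoffGr

end

noncomputable section

namespace BirkhoffGr

/-! ### Coefficients of formal Laurent series -/

/-! Two principles carry the proof. First, subspaces are controlled by their orders. Series with
distinct orders are independent, and `M ≤ W` with equal orders bounded below forces `M = W`
(`le_of_orders_subset`). A canonical span has orders `0, 2, …, 2n, 2n+1, 2n+2, …`, so it meets `H_-`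
only in zero, and an identity in `W` may be checked modulo `H_-`. Second, the involution `z ↦ -z`
(`sigma`) fixes `λ` and separates even from odd parts.

The first principle gives `p_0² = p_0`, hence `p_0 = 1`, and `W = ℂ[λ] ⊕ ℂ[λ]y` for `y = p_{2n+1}`.
So `y² = a(λ) + b(λ)y`. The root `y - b/2` of the completed square has a `sigma`-invariant square
and an odd leading power, so it is odd. The normalisation of `y` then gives `b = 0`
(`sigma_base_and_sq`). Thus `y² = f(λ)`, and the coefficients of `f` are read off from the square of
the series `y`. Conversely, a monic `f` of degree `2n+1` has a unique square root in `H` with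
leading coefficient `1`, and `ℂ[λ] ⊕ ℂ[λ]y` depends only on that root.

All ideals of relations come from one argument: modulo the proposed generators every polynomial has
a normal form `a(λ) + b(λ)y`, and `1, y` are independent over `ℂ[λ]` (`ker_eq_of_normal_form`).
Parity gives `p_{2m+1} = α_m(λ)y`, so all curves of the tower have one function field. The
codimension counts the gaps `1, 3, …, 2n-1`. For the index, `ker ∂̄_W` vanishes, and the cokernel
has the basis `λ^(n-j)/y`, `0 ≤ j < n`.

For the genus, every differential of the function field is `g · dx/y`. If `f` is squarefree, the
coordinate ring is Dedekind, so regularity at finite places puts `g` in it. At infinity the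
embedding into `H` turns `d` into `z d/dz`, and comparing orders leaves only `x^i dx/y` with `i <
n`. These are regular: at finite places by a Bezout relation between `f` and `f'`, at infinity by
means of the parameter `t = x^n/y`. -/

theorem zext {f g : H} (h : ∀ k, zcoeff f k = zcoeff g k) : f = g := by
  apply HahnSeries.ext
  funext k
  have := h (-k)
  simpa only [zcoeff, neg_neg] using this

theorem zcoeff_neg (f : H) (k : ℤ) : zcoeff (-f) k = -zcoeff f k := rfl

theorem zcoeff_sub (f g : H) (k : ℤ) : zcoeff (f - g) k = zcoeff f k - zcoeff g k := rfl

theorem zcoeff_sum {ι : Type*} (s : Finset ι) (f : ι → H) (k : ℤ) :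
    zcoeff (∑ i ∈ s, f i) k = ∑ i ∈ s, zcoeff (f i) k := by
  classical
  induction s using Finset.induction_on with
  | empty => simp [zcoeff_zero]
  | insert a s ha ih => rw [Finset.sum_insert ha, Finset.sum_insert ha, zcoeff_add, ih]

theorem zcoeff_zpow (a k : ℤ) : zcoeff (zpow a) k = if k = a then 1 else 0 := by
  unfold zcoeff zpow
  rw [HahnSeries.coeff_single]
  by_cases h : k = a
  · rw [if_pos h, if_pos (by omega)]
  · rw [if_neg h, if_neg (by omega)]

theorem zcoeff_zpow_mul (a : ℤ) (f : H) (k : ℤ) :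
    zcoeff (zpow a * f) k = zcoeff f (k - a) := by
  have h : zcoeff (zpow a * f) k =
      1 * HahnSeries.coeff (Γ := ℤ) (R := ℂ) f (-k - -a) := HahnSeries.coeff_single_mul
  rw [h, one_mul]
  unfold zcoeff
  congr 1
  ring

theorem one_eq_zpow : (1 : H) = zpow 0 := by
  unfold zpow
  rw [neg_zero]
  rfl

theorem zpow_mul_zpow (a b : ℤ) : zpow a * zpow b = zpow (a + b) := by
  apply zext
  intro k
  rw [zcoeff_zpow_mul, zcoeff_zpow, zcoeff_zpow]
  by_cases h : k = a + b
  · rw [if_pos h, if_pos (by omega)]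
  · rw [if_neg h, if_neg (by omega)]

theorem lam_pow (m : ℕ) : lam ^ m = zpow (2 * m) := by
  induction m with
  | zero => simp [one_eq_zpow]
  | succ m ih =>
    rw [pow_succ, ih, lam, zpow_mul_zpow]
    congr 1

/-! ### Multiplication in terms of power series -/

/-- Power series in `z⁻¹` as elements of `H`. -/
def ofPS : PowerSeries ℂ →+* H := HahnSeries.ofPowerSeries ℤ ℂ

theorem zcoeff_ofPS (P : PowerSeries ℂ) (i : ℕ) : zcoeff (ofPS P) (-i) = PowerSeries.coeff i P := by
  unfold zcoeff ofPS
  rw [neg_neg]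
  exact HahnSeries.ofPowerSeries_apply_coeff P i

theorem zcoeff_ofPS_of_pos (P : PowerSeries ℂ) {k : ℤ} (hk : 0 < k) : zcoeff (ofPS P) k = 0 := by
  have h : HahnSeries.coeff (HahnSeries.ofPowerSeries ℤ ℂ P) (-k) = if -k < 0 then 0
    else PowerSeries.coeff (-k).natAbs P := PowerSeries.coeff_coe P (-k)
  exact h.trans (if_pos (by omega))

/-- `f` has no powers of `z` above `z ^ a`. -/
def DegLE (f : H) (a : ℤ) : Prop := ∀ k : ℤ, a < k → zcoeff f k = 0

theorem DegLE.mono {f : H} {a b : ℤ} (h : DegLE f a) (hab : a ≤ b) : DegLE f b :=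
  fun k hk => h k (by omega)

/-- Factoring out `zpow a` reduces products in `H` to Cauchy products of power series. The
multiplicativity of leading terms and of `sigma`, and the Leibniz rule for `theta`, all rest on
this. -/
theorem DegLE.eq_ofPS {f : H} {a : ℤ} (h : DegLE f a) :
    f = zpow a * ofPS (PowerSeries.mk fun i => zcoeff f (a - i)) := by
  apply zext
  intro k
  rw [zcoeff_zpow_mul]
  rcases le_or_gt k a with hk | hk
  · obtain ⟨i, hi⟩ := Int.eq_ofNat_of_zero_le (sub_nonneg.mpr hk)
    have e : k - a = -(i : ℤ) := by omega
    rw [e, zcoeff_ofPS, PowerSeries.coeff_mk]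
    congr 1
    omega
  · rw [h k hk, zcoeff_ofPS_of_pos _ (by omega)]

theorem zcoeff_mul {f g : H} {a b : ℤ} (hf : DegLE f a) (hg : DegLE g b) (i : ℕ) :
    zcoeff (f * g) (a + b - i) =
      ∑ ij ∈ Finset.HasAntidiagonal.antidiagonal i, zcoeff f (a - ij.1) * zcoeff g (b - ij.2) := by
  have e : f * g = zpow (a + b) * ofPS (PowerSeries.mk (fun i => zcoeff f (a - i)) *
      PowerSeries.mk fun i => zcoeff g (b - i)) := by
    conv_lhs => rw [hf.eq_ofPS, hg.eq_ofPS]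
    rw [map_mul, ← zpow_mul_zpow]
    ring
  rw [e, zcoeff_zpow_mul]
  have e2 : a + b - i - (a + b) = -(i : ℤ) := by ring
  rw [e2, zcoeff_ofPS, PowerSeries.coeff_mul]
  simp only [PowerSeries.coeff_mk]

theorem DegLE.mul {f g : H} {a b : ℤ} (hf : DegLE f a) (hg : DegLE g b) :
    DegLE (f * g) (a + b) := by
  have e : f * g = zpow (a + b) * ofPS (PowerSeries.mk (fun i => zcoeff f (a - i)) *
      PowerSeries.mk fun i => zcoeff g (b - i)) := by
    conv_lhs => rw [hf.eq_ofPS, hg.eq_ofPS]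
    rw [map_mul, ← zpow_mul_zpow]
    ring
  intro k hk
  rw [e, zcoeff_zpow_mul, zcoeff_ofPS_of_pos _ (by omega)]

theorem zcoeff_mul_top {f g : H} {a b : ℤ} (hf : DegLE f a) (hg : DegLE g b) :
    zcoeff (f * g) (a + b) = zcoeff f a * zcoeff g b := by
  have := zcoeff_mul hf hg 0
  simpa using this

/-! ### Orders -/

theorem HasOrder.degLE {f : H} {s : ℤ} (h : HasOrder f s) : DegLE f s := h.2

theorem HasOrder.unique {f : H} {s t : ℤ} (hs : HasOrder f s) (ht : HasOrder f t) : s = t := by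
  rcases lt_trichotomy s t with h | h | h
  · exact absurd (hs.2 t h) ht.1
  · exact h
  · exact absurd (ht.2 s h) hs.1

theorem HasOrder.mul {f g : H} {a b : ℤ} (hf : HasOrder f a) (hg : HasOrder g b) :
    HasOrder (f * g) (a + b) := by
  refine ⟨?_, hf.degLE.mul hg.degLE⟩
  rw [zcoeff_mul_top hf.degLE hg.degLE]
  exact mul_ne_zero hf.1 hg.1

theorem HasOrder.ne_zero {f : H} {a : ℤ} (hf : HasOrder f a) : f ≠ 0 := by
  rintro rfl
  exact hf.1 (zcoeff_zero a)

theorem HasOrder.le_of_degLE {f : H} {a b : ℤ} (hf : HasOrder f a) (h : DegLE f b) : a ≤ b := by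
  by_contra hn
  exact hf.1 (h a (by omega))

theorem exists_hasOrder {f : H} (hf : f ≠ 0) : ∃ s, HasOrder f s := by
  refine ⟨-(HahnSeries.order (Γ := ℤ) (R := ℂ) f), ?_, ?_⟩
  · unfold zcoeff
    rw [neg_neg]
    exact HahnSeries.coeff_order_eq_zero.not.mpr hf
  · intro k hk
    exact HahnSeries.coeff_eq_zero_of_lt_order (Γ := ℤ) (R := ℂ) (x := f) (i := -k) (by omega)

theorem hasOrder_zpow (a : ℤ) : HasOrder (zpow a) a := by
  refine ⟨?_, fun k hk => ?_⟩
  · rw [zcoeff_zpow, if_pos rfl]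
    exact one_ne_zero
  · rw [zcoeff_zpow, if_neg (by omega)]

theorem mem_Hminus {f : H} : f ∈ Hminus ↔ DegLE f (-1) :=
  ⟨fun h k hk => h k (by omega), fun h k hk => h k (by omega)⟩

theorem HasOrder.mem_Hminus_iff {f : H} {a : ℤ} (hf : HasOrder f a) : f ∈ Hminus ↔ a < 0 := by
  rw [mem_Hminus]
  refine ⟨fun h => ?_, fun h => hf.degLE.mono (by omega)⟩
  have := hf.le_of_degLE h
  omega

/-! ### The substitution `z ↦ -z` -/

theorem bddBelow_support_neg (f : ℤ → ℂ) (h : ∃ a, ∀ k, a < k → f k = 0) :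
    BddBelow (Function.support fun k => f (-k)) := by
  obtain ⟨a, ha⟩ := h
  refine ⟨-a, fun k hk => ?_⟩
  by_contra hn
  exact hk (ha (-k) (by omega))

/-- The series `∑ f k z ^ k`. -/
def ofCoeffs (f : ℤ → ℂ) (h : ∃ a, ∀ k, a < k → f k = 0) : H :=
  (HahnSeries.ofSuppBddBelow (fun k => f (-k)) (bddBelow_support_neg f h) : HahnSeries ℤ ℂ)

theorem zcoeff_ofCoeffs (f : ℤ → ℂ) (h : ∃ a, ∀ k, a < k → f k = 0) (k : ℤ) :
    zcoeff (ofCoeffs f h) k = f k := by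
  unfold zcoeff ofCoeffs
  simp

theorem exists_degLE (f : H) : ∃ a, DegLE f a := by
  by_cases hf : f = 0
  · exact ⟨0, fun k _ => by rw [hf, zcoeff_zero]⟩
  · obtain ⟨s, hs⟩ := exists_hasOrder hf
    exact ⟨s, hs.degLE⟩

theorem zcoeff_one (k : ℤ) : zcoeff 1 k = if k = 0 then 1 else 0 := by
  rw [one_eq_zpow, zcoeff_zpow]

/-- The underlying function of the substitution `z ↦ -z`. -/
def sigmaFun (f : H) : H := ofCoeffs (fun k => k.negOnePow * zcoeff f k) (by
  obtain ⟨a, ha⟩ := exists_degLE f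
  exact ⟨a, fun k hk => by rw [ha k hk, mul_zero]⟩)

theorem zcoeff_sigmaFun (f : H) (k : ℤ) : zcoeff (sigmaFun f) k = k.negOnePow * zcoeff f k :=
  zcoeff_ofCoeffs _ _ k

/-- The substitution `z ↦ -z`. -/
def sigma : H →ₐ[ℂ] H := AlgHom.ofLinearMap
  { toFun := sigmaFun
    map_add' := fun f g => zext fun k => by
      simp only [zcoeff_sigmaFun, zcoeff_add]
      ring
    map_smul' := fun c f => zext fun k => by
      simp only [zcoeff_sigmaFun, zcoeff_smul, RingHom.id_apply]
      ring }
  (zext fun k => by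
    change zcoeff (sigmaFun 1) k = _
    rw [zcoeff_sigmaFun, zcoeff_one]
    split_ifs with h
    · simp [h]
    · simp)
  (fun f g => zext fun k => by
    change zcoeff (sigmaFun (f * g)) k = zcoeff (sigmaFun f * sigmaFun g) k
    obtain ⟨a, ha⟩ := exists_degLE f
    obtain ⟨b, hb⟩ := exists_degLE g
    have ha' : DegLE (sigmaFun f) a := fun k hk => by rw [zcoeff_sigmaFun, ha k hk, mul_zero]
    have hb' : DegLE (sigmaFun g) b := fun k hk => by rw [zcoeff_sigmaFun, hb k hk, mul_zero]
    rcases le_or_gt k (a + b) with hk | hk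
    · obtain ⟨i, hi⟩ := Int.eq_ofNat_of_zero_le (sub_nonneg.mpr hk)
      obtain rfl : k = a + b - i := by omega
      rw [zcoeff_sigmaFun, zcoeff_mul ha hb, zcoeff_mul ha' hb', Finset.mul_sum]
      refine Finset.sum_congr rfl fun ij hij => ?_
      rw [Finset.HasAntidiagonal.mem_antidiagonal] at hij
      have e : a + b - i = (a - ij.1) + (b - ij.2) := by omega
      rw [zcoeff_sigmaFun, zcoeff_sigmaFun, e, Int.negOnePow_add]
      push_cast
      ring
    · rw [zcoeff_sigmaFun, (ha.mul hb) k hk, (ha'.mul hb') k hk, mul_zero])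

theorem zcoeff_sigma (f : H) (k : ℤ) : zcoeff (sigma f) k = k.negOnePow * zcoeff f k :=
  zcoeff_sigmaFun f k

theorem sigma_lam : sigma lam = lam := zext fun k => by
  rw [zcoeff_sigma, lam, zcoeff_zpow]
  split_ifs with h
  · rw [h, Int.negOnePow_even 2 (by decide)]
    simp
  · simp

/-- `f` is odd in `z` iff its coefficients of even index vanish. -/
theorem sigma_eq_neg_iff {f : H} : sigma f = -f ↔ ∀ k, Even k → zcoeff f k = 0 := by
  constructor
  · intro h k hk
    have h1 := congrArg (fun g => zcoeff g k) h
    simp only [zcoeff_sigma, zcoeff_neg, Int.negOnePow_even k hk] at h1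
    push_cast at h1
    linear_combination h1 / 2
  · intro h
    apply zext
    intro k
    rw [zcoeff_sigma, zcoeff_neg]
    rcases Int.even_or_odd k with hk | hk
    · rw [h k hk]
      simp
    · rw [Int.negOnePow_odd k hk]
      simp

theorem zcoeff_odd_of_sigma_eq {f : H} (h : sigma f = f) {k : ℤ} (hk : Odd k) :
    zcoeff f k = 0 := by
  have h1 := congrArg (fun g => zcoeff g k) h
  simp only [zcoeff_sigma, Int.negOnePow_odd k hk] at h1
  push_cast at h1
  linear_combination -h1 / 2

/-! ### The derivation `z d/dz` -/

/-- The underlying function of the derivation `z d/dz`. -/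
def thetaFun (f : H) : H := ofCoeffs (fun k => k * zcoeff f k) (by
  obtain ⟨a, ha⟩ := exists_degLE f
  exact ⟨a, fun k hk => by rw [ha k hk, mul_zero]⟩)

theorem zcoeff_thetaFun (f : H) (k : ℤ) : zcoeff (thetaFun f) k = k * zcoeff f k :=
  zcoeff_ofCoeffs _ _ k

/-- The derivation `z d/dz`. -/
def theta : Derivation ℂ H H := Derivation.mk'
  { toFun := thetaFun
    map_add' := fun f g => zext fun k => by
      simp only [zcoeff_thetaFun, zcoeff_add]
      ring
    map_smul' := fun c f => zext fun k => by
      simp only [zcoeff_thetaFun, zcoeff_smul, RingHom.id_apply]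
      ring }
  (fun f g => zext fun k => by
    change zcoeff (thetaFun (f * g)) k = zcoeff (f * thetaFun g + g * thetaFun f) k
    obtain ⟨a, ha⟩ := exists_degLE f
    obtain ⟨b, hb⟩ := exists_degLE g
    have ha' : DegLE (thetaFun f) a := fun k hk => by rw [zcoeff_thetaFun, ha k hk, mul_zero]
    have hb' : DegLE (thetaFun g) b := fun k hk => by rw [zcoeff_thetaFun, hb k hk, mul_zero]
    rcases le_or_gt k (a + b) with hk | hk
    · obtain ⟨i, hi⟩ := Int.eq_ofNat_of_zero_le (sub_nonneg.mpr hk)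
      obtain rfl : k = a + b - i := by omega
      rw [zcoeff_thetaFun, zcoeff_add, mul_comm g, zcoeff_mul ha hb, zcoeff_mul ha hb',
        zcoeff_mul ha' hb, Finset.mul_sum, ← Finset.sum_add_distrib]
      refine Finset.sum_congr rfl fun ij hij => ?_
      rw [Finset.HasAntidiagonal.mem_antidiagonal] at hij
      have e : a + b - i = (a - ij.1) + (b - ij.2) := by omega
      rw [zcoeff_thetaFun, zcoeff_thetaFun, e]
      push_cast
      ring
    · rw [zcoeff_thetaFun, zcoeff_add, (ha.mul hb) k hk, (ha.mul hb') k hk, mul_comm g,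
        (ha'.mul hb) k hk, mul_zero, add_zero])

theorem zcoeff_theta (f : H) (k : ℤ) : zcoeff (theta f) k = k * zcoeff f k :=
  zcoeff_thetaFun f k

theorem theta_lam : theta lam = (2 : ℂ) • lam := zext fun k => by
  rw [zcoeff_theta, zcoeff_smul, lam, zcoeff_zpow]
  split_ifs with h
  · rw [h]; norm_num
  · simp

/-! ### Polynomials in `λ` -/

theorem zcoeff_aeval_lam (a : ℂ[X]) (m : ℕ) :
    zcoeff (Polynomial.aeval lam a) (2 * m) = a.coeff m := by
  rw [Polynomial.aeval_eq_sum_range, zcoeff_sum]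
  simp only [zcoeff_smul, lam_pow, zcoeff_zpow]
  rw [Finset.sum_eq_single m]
  · simp
  · intro b _ hb
    rw [if_neg (by omega), mul_zero]
  · intro hm
    rw [a.coeff_eq_zero_of_natDegree_lt (by simpa using hm), zero_mul]

theorem zcoeff_aeval_lam_eq_zero (a : ℂ[X]) {k : ℤ} (hk : ∀ m : ℕ, k ≠ 2 * m) :
    zcoeff (Polynomial.aeval lam a) k = 0 := by
  rw [Polynomial.aeval_eq_sum_range, zcoeff_sum]
  refine Finset.sum_eq_zero fun i _ => ?_
  rw [zcoeff_smul, lam_pow, zcoeff_zpow, if_neg (hk i), mul_zero]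

theorem hasOrder_aeval_lam {a : ℂ[X]} (ha : a ≠ 0) :
    HasOrder (Polynomial.aeval lam a) (2 * a.natDegree) := by
  constructor
  · rw [zcoeff_aeval_lam]
    exact Polynomial.leadingCoeff_ne_zero.mpr ha
  · intro k hk
    by_cases h : ∃ m : ℕ, k = 2 * m
    · obtain ⟨m, rfl⟩ := h
      rw [zcoeff_aeval_lam, a.coeff_eq_zero_of_natDegree_lt (by omega)]
    · push Not at h
      exact zcoeff_aeval_lam_eq_zero a h

theorem aeval_lam_injective : Function.Injective (Polynomial.aeval (R := ℂ) lam) := by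
  rw [injective_iff_map_eq_zero]
  intro a ha
  by_contra h
  exact (hasOrder_aeval_lam h).ne_zero ha

theorem sigma_aeval_lam (a : ℂ[X]) :
    sigma (Polynomial.aeval lam a) = Polynomial.aeval lam a := by
  rw [← Polynomial.aeval_algHom_apply, sigma_lam]

theorem even_add_odd_eq_zero {u v : H} (hu : sigma u = u) (hv : sigma v = -v) (h : u + v = 0) :
    u = 0 ∧ v = 0 := by
  have h1 := congrArg sigma h
  rw [map_add, map_zero, hu, hv] at h1
  have h2 : (2 : H) ≠ 0 := by
    have : (2 : H) = algebraMap ℂ H 2 := by rw [map_ofNat]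
    rw [this, Ne, map_eq_zero]
    norm_num
  have h3 : 2 * u = 0 := by linear_combination h + h1
  have h4 : u = 0 := by simpa [h2] using h3
  exact ⟨h4, by simpa [h4] using h⟩

/-! ### Families with distinct orders -/

section Families

variable {ι : Type*} {q : ι → H} {d : ι → ℤ}

/-- Distinct orders rule out cancellation: the index of largest order in the support provides the
leading term. -/
theorem hasOrder_linearCombination (hd : Function.Injective d) (hq : ∀ i, HasOrder (q i) (d i))
    {c : ι →₀ ℂ} (hc : c ≠ 0) : ∃ i, HasOrder (Finsupp.linearCombination ℂ q c) (d i) := by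
  obtain ⟨i, hi, hmax⟩ := c.support.exists_max_image d (Finsupp.support_nonempty_iff.mpr hc)
  have hlt : ∀ j ∈ c.support, j ≠ i → d j < d i := fun j hj hji =>
    lt_of_le_of_ne (hmax j hj) (fun h => hji (hd h))
  refine ⟨i, ?_, fun k hk => ?_⟩
  · rw [Finsupp.linearCombination_apply, Finsupp.sum, zcoeff_sum, Finset.sum_eq_single i]
    · rw [zcoeff_smul]
      exact mul_ne_zero (Finsupp.mem_support_iff.mp hi) (hq i).1
    · intro j hj hji
      rw [zcoeff_smul, (hq j).2 _ (hlt j hj hji), mul_zero]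
    · exact fun h => absurd hi h
  · rw [Finsupp.linearCombination_apply, Finsupp.sum, zcoeff_sum]
    refine Finset.sum_eq_zero fun j hj => ?_
    rw [zcoeff_smul, (hq j).2 k (by have := hmax j hj; omega), mul_zero]

theorem linearIndependent_of_hasOrder (hd : Function.Injective d)
    (hq : ∀ i, HasOrder (q i) (d i)) : LinearIndependent ℂ q := by
  rw [linearIndependent_iff]
  intro c hc
  by_contra h
  obtain ⟨i, hi⟩ := hasOrder_linearCombination hd hq h
  exact hi.ne_zero hc

theorem linearIndependent_mkQ_of_hasOrder (hd : Function.Injective d)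
    (hq : ∀ i, HasOrder (q i) (d i)) (h0 : ∀ i, 0 ≤ d i) :
    LinearIndependent ℂ fun i => Hminus.mkQ (q i) := by
  rw [linearIndependent_iff]
  intro c hc
  by_contra h
  obtain ⟨i, hi⟩ := hasOrder_linearCombination hd hq h
  have h1 : Hminus.mkQ (Finsupp.linearCombination ℂ q c) = 0 := by
    rw [← hc, Finsupp.apply_linearCombination]
    rfl
  rw [Submodule.mkQ_apply, Submodule.Quotient.mk_eq_zero, hi.mem_Hminus_iff] at h1
  have := h0 i
  omega

theorem orders_span_range (hd : Function.Injective d) (hq : ∀ i, HasOrder (q i) (d i)) :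
    orders (Submodule.span ℂ (Set.range q)) = Set.range d := by
  ext s
  constructor
  · rintro ⟨w, hw, hs⟩
    obtain ⟨c, rfl⟩ := Finsupp.mem_span_range_iff_exists_finsupp.mp hw
    have hc : c ≠ 0 := by
      rintro rfl
      exact hs.ne_zero (by simp)
    obtain ⟨i, hi⟩ := hasOrder_linearCombination hd hq hc
    rw [Finsupp.linearCombination_apply] at hi
    exact ⟨i, hi.unique hs⟩
  · rintro ⟨i, rfl⟩
    exact ⟨q i, Submodule.subset_span ⟨i, rfl⟩, hq i⟩

end Families

theorem degLE_sub_smul {f g : H} {s : ℤ} (hf : DegLE f s) (hg : HasOrder g s) :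
    DegLE (f - (zcoeff f s / zcoeff g s) • g) (s - 1) := by
  intro k hk
  rw [zcoeff_sub, zcoeff_smul]
  rcases eq_or_lt_of_le (show s ≤ k by omega) with rfl | h
  · rw [div_mul_cancel₀ _ hg.1, sub_self]
  · rw [hf k h, hg.2 k h, mul_zero, sub_zero]

/-- A subspace with orders bounded below is determined by its orders among larger ones. -/
theorem le_of_orders_subset {M W : Submodule ℂ H} (h : M ≤ W) (ho : orders W ⊆ orders M) {b : ℤ}
    (hb : ∀ s ∈ orders W, b ≤ s) : W ≤ M := by
  -- Induction on the order above `b`: an element of `M` of the same order cancels the leading term,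
  -- and below `b` only zero is left.
  have key : ∀ N : ℕ, ∀ w ∈ W, DegLE w (b + N - 1) → w ∈ M := by
    intro N
    induction N with
    | zero =>
      intro w hw hd
      by_cases h0 : w = 0
      · rw [h0]; exact M.zero_mem
      · obtain ⟨s, hs⟩ := exists_hasOrder h0
        have h1 := hb s ⟨w, hw, hs⟩
        have h2 := hs.le_of_degLE hd
        exfalso
        push_cast at h2
        omega
    | succ N ih =>
      intro w hw hd
      by_cases h0 : zcoeff w (b + N) = 0
      · refine ih w hw fun k hk => ?_
        by_cases hk' : k = b + N
        · rw [hk', h0]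
        · exact hd k (by push_cast; omega)
      · have hs : HasOrder w (b + N) := ⟨h0, fun k hk => hd k (by push_cast; omega)⟩
        obtain ⟨g, hg, hgs⟩ := ho ⟨w, hw, hs⟩
        have h1 := ih _ (W.sub_mem hw (W.smul_mem (zcoeff w (b + N) / zcoeff g (b + N)) (h hg)))
          (degLE_sub_smul hs.degLE hgs)
        have h2 := M.add_mem h1 (M.smul_mem (zcoeff w (b + N) / zcoeff g (b + N)) hg)
        rwa [sub_add_cancel] at h2
  intro w hw
  obtain ⟨a, ha⟩ := exists_degLE w
  exact key (a - b + 1).toNat w hw (ha.mono (by omega))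

/-- An approximation in `W` accurate down to order `b` is already exact: a better one would differ
from it by an element of `W` of order below `b`. -/
theorem isClosedSubspace_of_orders {W : Submodule ℂ H} {b : ℤ} (hb : ∀ s ∈ orders W, b ≤ s) :
    IsClosedSubspace W := by
  intro f hf
  obtain ⟨w, hw, hfw⟩ := hf (b - 1)
  have h0 : f - w = 0 := by
    by_contra hne
    obtain ⟨s, hs⟩ := exists_hasOrder hne
    obtain ⟨w', hw', hfw'⟩ := hf (s - 1)
    have hsb : s ≤ b - 1 := hs.le_of_degLE hfw
    have ho : HasOrder (w' - w) s := by
      have e : w' - w = (f - w) - (f - w') := by ring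
      refine ⟨?_, fun k hk => ?_⟩
      · rw [e, zcoeff_sub, hfw' s (by omega), sub_zero]
        exact hs.1
      · rw [e, zcoeff_sub, hfw' k (by omega), hs.2 k hk, sub_zero]
    have := hb s ⟨_, W.sub_mem hw' hw, ho⟩
    omega
  rw [sub_eq_zero.mp h0]
  exact hw

/-! ### The span of a canonical family -/

theorem compl_posOrders (n : ℕ) :
    (posOrders n)ᶜ = Set.range fun j : Fin n => 2 * (j : ℕ) + 1 := by
  ext k
  simp only [posOrders, Set.mem_compl_iff, Set.mem_ofPred_eq, Set.mem_range, not_or,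
    Nat.not_even_iff_odd]
  constructor
  · rintro ⟨⟨j, rfl⟩, h⟩
    exact ⟨⟨j, by omega⟩, rfl⟩
  · rintro ⟨j, rfl⟩
    have := j.2
    exact ⟨⟨j, rfl⟩, by omega⟩

theorem gap_injective (n : ℕ) : Function.Injective fun j : Fin n => 2 * (j : ℕ) + 1 := by
  intro a b h
  ext
  simp only at h
  omega

theorem two_mul_mem_posOrders (n m : ℕ) : 2 * m ∈ posOrders n := Or.inl ⟨m, by ring⟩

theorem odd_mem_posOrders {n m : ℕ} (h : n ≤ m) : 2 * m + 1 ∈ posOrders n := Or.inr (by omega)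

theorem mem_posOrders_iff {n i : ℕ} :
    i ∈ posOrders n ↔ (∃ m, i = 2 * m) ∨ ∃ m, n ≤ m ∧ i = 2 * m + 1 := by
  constructor
  · intro h
    rcases Nat.even_or_odd' i with ⟨m, rfl | rfl⟩
    · exact Or.inl ⟨m, rfl⟩
    · refine Or.inr ⟨m, ?_, rfl⟩
      rcases h with h | h
      · exact absurd h (by simp)
      · omega
  · rintro (⟨m, rfl⟩ | ⟨m, hm, rfl⟩)
    · exact two_mul_mem_posOrders n m
    · exact odd_mem_posOrders hm

namespace IsCanonical

variable {n : ℕ} {p : ℕ → H}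

theorem degLE_odd (hp : IsCanonical n p) {m : ℕ} (hm : n ≤ m) :
    DegLE (p (2 * m + 1)) (2 * m + 1) :=
  fun k hk => hp.odd_pos m hm k (by omega) (by omega) (Or.inr (by omega))

theorem hasOrder (hp : IsCanonical n p) {i : ℕ} (hi : i ∈ posOrders n) : HasOrder (p i) i := by
  rcases mem_posOrders_iff.mp hi with ⟨m, rfl⟩ | ⟨m, hm, rfl⟩
  · rw [hp.even_eq]
    have h0 : HasOrder (p 0) 0 := ⟨by rw [hp.zero_lead]; exact one_ne_zero, hp.zero_pos⟩
    simpa using (hasOrder_zpow (2 * m)).mul h0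
  · have := hp.odd_lead m hm
    push_cast
    exact ⟨by rw [this]; exact one_ne_zero, hp.degLE_odd hm⟩

end IsCanonical

theorem wSpan_eq_span_range (n : ℕ) (p : ℕ → H) :
    wSpan n p = Submodule.span ℂ (Set.range fun i : posOrders n => p i) := by
  rw [wSpan, Set.image_eq_range]

theorem cast_posOrders_injective (n : ℕ) :
    Function.Injective fun i : posOrders n => ((i : ℕ) : ℤ) :=
  fun a b h => Subtype.ext (by simpa using h)

namespace IsCanonical

variable {n : ℕ} {p : ℕ → H}

theorem linearIndependent (hp : IsCanonical n p) :
    LinearIndependent ℂ fun i : posOrders n => p i :=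
  linearIndependent_of_hasOrder (cast_posOrders_injective n) fun i => hp.hasOrder i.2

theorem orders_wSpan (hp : IsCanonical n p) :
    orders (wSpan n p) = Set.range fun i : posOrders n => ((i : ℕ) : ℤ) := by
  rw [wSpan_eq_span_range]
  exact orders_span_range (cast_posOrders_injective n) fun i => hp.hasOrder i.2

theorem mem_orders_wSpan (hp : IsCanonical n p) {k : ℕ} :
    (k : ℤ) ∈ orders (wSpan n p) ↔ k ∈ posOrders n := by
  rw [hp.orders_wSpan]
  constructor
  · rintro ⟨i, hi⟩
    have : (i : ℕ) = k := by simpa using hi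
    rw [← this]
    exact i.2
  · exact fun h => ⟨⟨k, h⟩, rfl⟩

theorem nonneg_of_mem_orders (hp : IsCanonical n p) {s : ℤ} (hs : s ∈ orders (wSpan n p)) :
    0 ≤ s := by
  rw [hp.orders_wSpan] at hs
  obtain ⟨i, rfl⟩ := hs
  exact Int.natCast_nonneg _

/-- This is what allows identities in `W` to be verified on nonnegative powers of `z` only. -/
theorem wSpan_inf_Hminus (hp : IsCanonical n p) : wSpan n p ⊓ Hminus = ⊥ := by
  rw [eq_bot_iff]
  rintro w ⟨hw, hw'⟩
  by_contra h
  obtain ⟨s, hs⟩ := exists_hasOrder h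
  have h1 := hp.nonneg_of_mem_orders ⟨w, hw, hs⟩
  have h2 := hs.mem_Hminus_iff.mp hw'
  omega

theorem codim_wSpan (hp : IsCanonical n p) : codim (wSpan n p) = n := by
  have e : {k : ℕ | (k : ℤ) ∉ orders (wSpan n p)} =
      Set.range fun j : Fin n => 2 * (j : ℕ) + 1 := by
    rw [← compl_posOrders]
    ext k
    simp only [Set.mem_ofPred_eq, hp.mem_orders_wSpan, Set.mem_compl_iff]
  rw [codim, e, ← Set.image_univ, (gap_injective n).encard_image, Set.encard_univ]
  simp

end IsCanonical

/-- A family with all nonnegative orders spans `H` modulo `H_-`. -/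
theorem span_mkQ_eq_top {q : ℕ → H} (hq : ∀ i : ℕ, HasOrder (q i) i) :
    Submodule.span ℂ (Set.range fun i => Hminus.mkQ (q i)) = ⊤ := by
  set S := Submodule.span ℂ (Set.range fun i => Hminus.mkQ (q i)) with hS
  have key : ∀ (N : ℕ) (f : H), DegLE f (N - 1) → Hminus.mkQ f ∈ S := by
    intro N
    induction N with
    | zero =>
      intro f hf
      have : Hminus.mkQ f = 0 := by
        rw [Submodule.mkQ_apply, Submodule.Quotient.mk_eq_zero, mem_Hminus]
        simpa using hf
      rw [this]
      exact S.zero_mem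
    | succ N ih =>
      intro f hf
      have h1 := ih _ (degLE_sub_smul (by simpa using hf) (hq N))
      rw [map_sub, map_smul] at h1
      have h2 := S.add_mem h1 (S.smul_mem (zcoeff f N / zcoeff (q N) N)
        (Submodule.subset_span ⟨N, rfl⟩))
      rwa [sub_add_cancel] at h2
  rw [eq_top_iff]
  intro x _
  obtain ⟨f, rfl⟩ := Hminus.mkQ_surjective x
  obtain ⟨a, ha⟩ := exists_degLE f
  exact key (a + 1).toNat f (ha.mono (by omega))

theorem range_projPlus (W : Submodule ℂ H) :
    LinearMap.range (projPlus W) = W.map Hminus.mkQ := by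
  rw [projPlus, LinearMap.range_comp, Submodule.range_subtype]

/-- Filling the gaps with monomials gives a family `q` with every nonnegative order, hence a basis
modulo `H_-`. The `n` gap monomials span a complement of the image of `W`. -/
theorem IsCanonical.rank_quotient_range_projPlus {n : ℕ} {p : ℕ → H} (hp : IsCanonical n p) :
    Module.rank ℂ ((H ⧸ Hminus) ⧸ LinearMap.range (projPlus (wSpan n p))) = n := by
  classical
  let q : ℕ → H := fun i => if i ∈ posOrders n then p i else zpow i
  have hq : ∀ i : ℕ, HasOrder (q i) i := by
    intro i
    by_cases hi : i ∈ posOrders n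
    · simp only [q, if_pos hi]
      exact hp.hasOrder hi
    · simp only [q, if_neg hi]
      exact hasOrder_zpow i
  have hli : LinearIndependent ℂ fun i => Hminus.mkQ (q i) :=
    linearIndependent_mkQ_of_hasOrder (d := fun i : ℕ => (i : ℤ)) Nat.cast_injective hq
      fun i => Int.natCast_nonneg i
  have hr : LinearMap.range (projPlus (wSpan n p)) =
      Submodule.span ℂ ((fun i => Hminus.mkQ (q i)) '' posOrders n) := by
    rw [range_projPlus, wSpan, Submodule.map_span, Set.image_image]
    congr 1
    refine Set.image_congr fun i hi => ?_
    simp only [q, if_pos hi]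
  have hc : IsCompl (LinearMap.range (projPlus (wSpan n p)))
      (Submodule.span ℂ ((fun i => Hminus.mkQ (q i)) '' (posOrders n)ᶜ)) := by
    constructor
    · rw [hr]
      exact hli.disjoint_span_image disjoint_compl_right
    · rw [codisjoint_iff, hr, ← Submodule.span_union, ← Set.image_union, Set.union_compl_self,
        Set.image_univ, span_mkQ_eq_top hq]
  rw [(Submodule.quotientEquivOfIsCompl _ _ hc).rank_eq, compl_posOrders, ← Set.range_comp]
  have hli' := hli.comp _ (gap_injective n)
  rw [rank_span hli', Cardinal.mk_range_eq _ hli'.injective]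
  simp

/-! ### The `ℂ[λ]`-module generated by `1` and an odd series -/

open Polynomial in
/-- The linear map `(a, b) ↦ a(x) + b(x) y`. -/
def pairMap {S : Type*} [CommRing S] [Algebra ℂ S] (x y : S) : ℂ[X] × ℂ[X] →ₗ[ℂ] S :=
  (aeval x).toLinearMap.coprod (LinearMap.mulRight ℂ y ∘ₗ (aeval x).toLinearMap)

theorem pairMap_apply {S : Type*} [CommRing S] [Algebra ℂ S] (x y : S) (a b : ℂ[X]) :
    pairMap x y (a, b) = Polynomial.aeval x a + Polynomial.aeval x b * y := by
  simp [pairMap]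

theorem HasOrder.inv {f : H} {a : ℤ} (h : HasOrder f a) : HasOrder f⁻¹ (-a) := by
  obtain ⟨s, hs⟩ := exists_hasOrder (inv_ne_zero h.ne_zero)
  have h1 := h.mul hs
  rw [mul_inv_cancel₀ h.ne_zero, one_eq_zpow] at h1
  have h2 := h1.unique (hasOrder_zpow 0)
  obtain rfl : s = -a := by omega
  exact hs

theorem sigma_aeval_mul {y : H} (hy : sigma y = -y) (b : ℂ[X]) :
    sigma (Polynomial.aeval lam b * y) = -(Polynomial.aeval lam b * y) := by
  rw [map_mul, sigma_aeval_lam, hy, mul_neg]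

/-- `1` and an odd series `y` are linearly independent over `ℂ[λ]`. -/
theorem aeval_add_mul_eq_zero {y : H} (hy : sigma y = -y) (hy0 : y ≠ 0) {a b : ℂ[X]}
    (h : Polynomial.aeval lam a + Polynomial.aeval lam b * y = 0) : a = 0 ∧ b = 0 := by
  obtain ⟨h1, h2⟩ := even_add_odd_eq_zero (sigma_aeval_lam a) (sigma_aeval_mul hy b) h
  refine ⟨aeval_lam_injective (by rw [h1, map_zero]), aeval_lam_injective ?_⟩
  rw [map_zero]
  exact (mul_eq_zero.mp h2).resolve_right hy0

/-! ### Structure of a multiplicatively closed canonical span -/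

namespace IsMultCanonical

variable {n : ℕ} {p : ℕ → H}

theorem mem_wSpan {i : ℕ} (hi : i ∈ posOrders n) : p i ∈ wSpan n p :=
  Submodule.subset_span ⟨i, hi, rfl⟩

theorem mul_mem_wSpan (hp : IsMultCanonical n p) {v w : H} (hv : v ∈ wSpan n p)
    (hw : w ∈ wSpan n p) : v * w ∈ wSpan n p := by
  refine (Submodule.mul_le (M := wSpan n p) (N := wSpan n p) (P := wSpan n p)).mp ?_ v hv w hw
  rw [wSpan, Submodule.span_mul_span, Submodule.span_le]
  rintro _ ⟨_, ⟨i, hi, rfl⟩, _, ⟨j, hj, rfl⟩, rfl⟩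
  exact hp.2 i hi j hj

/-- Since `p_0` has leading term `1`, the difference `p_0² - p_0` lies in `W ∩ H_- = 0`; a nonzero
idempotent of a field is `1`. -/
theorem zero_eq_one (hp : IsMultCanonical n p) : p 0 = 1 := by
  have h0 : (0 : ℕ) ∈ posOrders n := two_mul_mem_posOrders n 0
  have hd : DegLE (p 0) 0 := hp.1.zero_pos
  have h1 : p 0 * p 0 - p 0 ∈ wSpan n p ⊓ Hminus := by
    refine ⟨Submodule.sub_mem _ (hp.2 0 h0 0 h0) (mem_wSpan h0), ?_⟩
    intro k hk
    rw [zcoeff_sub]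
    rcases eq_or_lt_of_le hk with rfl | hk
    · have := zcoeff_mul_top hd hd
      rw [hp.1.zero_lead, add_zero] at this
      rw [this, hp.1.zero_lead]
      norm_num
    · rw [(hd.mul hd) k (by omega), hd k hk, sub_zero]
  rw [hp.1.wSpan_inf_Hminus, Submodule.mem_bot] at h1
  have h2 : p 0 * (p 0 - 1) = 0 := by rw [← h1]; ring
  have h3 := (mul_eq_zero.mp h2).resolve_left (hp.1.hasOrder h0).ne_zero
  exact sub_eq_zero.mp h3

theorem even_eq_lam_pow (hp : IsMultCanonical n p) (m : ℕ) : p (2 * m) = lam ^ m := by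
  rw [hp.1.even_eq, hp.zero_eq_one, mul_one, lam_pow]

/-- `W` as a subalgebra of `H`. -/
def toSubalgebra (hp : IsMultCanonical n p) : Subalgebra ℂ H :=
  (wSpan n p).toSubalgebra (by rw [← hp.zero_eq_one]; exact mem_wSpan (two_mul_mem_posOrders n 0))
    fun _ _ hv hw => hp.mul_mem_wSpan hv hw

theorem lam_mem_wSpan (hp : IsMultCanonical n p) : lam ∈ wSpan n p := by
  rw [← pow_one lam, ← hp.even_eq_lam_pow]
  exact mem_wSpan (two_mul_mem_posOrders n 1)

theorem aeval_mem_wSpan (hp : IsMultCanonical n p) (a : ℂ[X]) :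
    Polynomial.aeval lam a ∈ wSpan n p := by
  have h := Algebra.adjoin_le (S := hp.toSubalgebra) (s := {lam})
    (Set.singleton_subset_iff.mpr hp.lam_mem_wSpan)
  exact h (Polynomial.aeval_mem_adjoin_singleton ℂ lam)

theorem hasOrder_base (hp : IsMultCanonical n p) : HasOrder (p (2 * n + 1)) (2 * n + 1) := by
  simpa using hp.1.hasOrder (odd_mem_posOrders le_rfl)

/-- The series `λ^m` and `λ^(m-n) p_{2n+1}` already realise every order of `W`, so comparison of
orders leaves no room for further elements. -/
theorem wSpan_eq_range (hp : IsMultCanonical n p) :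
    wSpan n p = LinearMap.range (pairMap lam (p (2 * n + 1))) := by
  have hle : LinearMap.range (pairMap lam (p (2 * n + 1))) ≤ wSpan n p := by
    rintro _ ⟨⟨a, b⟩, rfl⟩
    rw [pairMap_apply]
    exact Submodule.add_mem _ (hp.aeval_mem_wSpan a) (hp.mul_mem_wSpan (hp.aeval_mem_wSpan b)
      (mem_wSpan (odd_mem_posOrders le_rfl)))
  refine le_antisymm (le_of_orders_subset hle ?_ fun s => hp.1.nonneg_of_mem_orders) hle
  rw [hp.1.orders_wSpan]
  rintro _ ⟨⟨i, hi⟩, rfl⟩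
  rcases mem_posOrders_iff.mp hi with ⟨m, rfl⟩ | ⟨m, hm, rfl⟩
  · refine ⟨_, ⟨(Polynomial.X ^ m, 0), rfl⟩, ?_⟩
    rw [pairMap_apply]
    simpa [lam_pow] using hasOrder_zpow (2 * m)
  · refine ⟨_, ⟨(0, Polynomial.X ^ (m - n)), rfl⟩, ?_⟩
    rw [pairMap_apply]
    have := (hasOrder_zpow (2 * (m - n : ℕ))).mul hp.hasOrder_base
    have e : (2 * (m - n : ℕ) : ℤ) + (2 * n + 1) = (2 * m + 1 : ℕ) := by omega
    rw [e] at this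
    simpa [lam_pow] using this

/-- Complete the square in the quadratic equation of `y` over `ℂ[λ]`. The shifted root `q` has a
square fixed by `sigma`, so `sigma q = ±q`, and its odd leading power selects the minus sign. -/
theorem sigma_base_and_sq (hp : IsMultCanonical n p) : sigma (p (2 * n + 1)) = -p (2 * n + 1) ∧
    ∃ f : ℂ[X], p (2 * n + 1) ^ 2 = Polynomial.aeval lam f := by
  set y := p (2 * n + 1) with hy
  have hyW : y ∈ wSpan n p := mem_wSpan (odd_mem_posOrders le_rfl)
  have h1 := hp.mul_mem_wSpan hyW hyW
  rw [hp.wSpan_eq_range] at h1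
  obtain ⟨⟨a, b⟩, hab⟩ := h1
  rw [pairMap_apply, ← hy] at hab
  have hhalf : ∃ c : ℂ[X], b = c + c := ⟨Polynomial.C (1 / 2) * b, by
    rw [← add_mul, ← Polynomial.C_add]; norm_num⟩
  obtain ⟨c, rfl⟩ := hhalf
  set q := y - Polynomial.aeval lam c with hq
  have hqq : q * q = Polynomial.aeval lam (a + c * c) := by
    rw [map_add, map_mul]
    rw [map_add] at hab
    rw [hq]
    linear_combination -hab
  have hs : sigma q * sigma q = q * q := by rw [← map_mul, hqq, sigma_aeval_lam]
  have hlead : zcoeff q (2 * n + 1) = 1 := by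
    rw [hq, zcoeff_sub, zcoeff_aeval_lam_eq_zero c (fun m => by omega), sub_zero]
    exact hp.1.odd_lead n le_rfl
  have hsq : sigma q = -q := by
    rcases mul_self_eq_mul_self_iff.mp hs with h | h
    · rw [zcoeff_odd_of_sigma_eq h ⟨n, rfl⟩] at hlead
      exact absurd hlead zero_ne_one
    · exact h
  -- The even coefficients of `q` vanish by oddness, and those of `y` at nonnegative even powers by
  -- canonical normalisation; their difference is the coefficients of `c`.
  have hc : c = 0 := by
    ext m
    have h2 := sigma_eq_neg_iff.mp hsq (2 * m) ⟨m, by ring⟩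
    rw [hq, zcoeff_sub, zcoeff_aeval_lam] at h2
    have h3 : zcoeff y (2 * m) = 0 :=
      hp.1.odd_pos n le_rfl (2 * m) (by omega) (by omega) (Or.inl ⟨m, by ring⟩)
    rw [h3] at h2
    rw [Polynomial.coeff_zero]
    linear_combination -h2
  have hqy : q = y := by rw [hq, hc, map_zero, sub_zero]
  rw [hqy] at hsq hqq
  exact ⟨hsq, _, by rw [pow_two, hqq]⟩

theorem sigma_base (hp : IsMultCanonical n p) : sigma (p (2 * n + 1)) = -p (2 * n + 1) :=
  hp.sigma_base_and_sq.1

end IsMultCanonical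

/-! ### The polynomial `f` and the universal formulas for its coefficients -/

theorem basePoly_coeff (n : ℕ) (u : Fin (2 * n + 1) → ℂ) (m : Fin (2 * n + 1)) :
    (basePoly n u).coeff m = u m := by
  have hm := m.2
  rw [basePoly, Polynomial.coeff_add, Polynomial.coeff_X_pow, if_neg (by omega), zero_add,
    Polynomial.finsetSum_coeff, Finset.sum_eq_single m]
  · simp
  · intro i _ hi
    rw [Polynomial.coeff_C_mul, Polynomial.coeff_X_pow, if_neg (fun h => hi (Fin.ext h.symm)),
      mul_zero]
  · simp

theorem degree_sum_lt (n : ℕ) (u : Fin (2 * n + 1) → ℂ) :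
    (∑ m : Fin (2 * n + 1), Polynomial.C (u m) * Polynomial.X ^ (m : ℕ)).degree <
      ((2 * n + 1 : ℕ) : WithBot ℕ) := by
  refine (Polynomial.degree_sum_le _ _).trans_lt ((Finset.sup_lt_iff (WithBot.bot_lt_coe _)).mpr ?_)
  intro m _
  refine (Polynomial.degree_C_mul_X_pow_le _ _).trans_lt ?_
  exact_mod_cast m.2

theorem basePoly_monic (n : ℕ) (u : Fin (2 * n + 1) → ℂ) : (basePoly n u).Monic :=
  Polynomial.monic_X_pow_add (degree_sum_lt n u)

theorem basePoly_natDegree (n : ℕ) (u : Fin (2 * n + 1) → ℂ) :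
    (basePoly n u).natDegree = 2 * n + 1 :=
  Polynomial.natDegree_eq_of_degree_eq_some <| by
    rw [basePoly, Polynomial.degree_add_eq_left_of_degree_lt
      (by rw [Polynomial.degree_X_pow]; exact degree_sum_lt n u), Polynomial.degree_X_pow]

theorem eq_basePoly {n : ℕ} {f : ℂ[X]} (hf : f.natDegree = 2 * n + 1) (hm : f.Monic) :
    f = basePoly n fun m => f.coeff m := by
  ext k
  rcases lt_trichotomy k (2 * n + 1) with h | h | h
  · exact (basePoly_coeff n (fun m => f.coeff m) ⟨k, h⟩).symm
  · have h1 := hm.coeff_natDegree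
    have h2 := (basePoly_monic n fun m => f.coeff m).coeff_natDegree
    rw [basePoly_natDegree] at h2
    rw [hf] at h1
    rw [h, h1, h2]
  · rw [Polynomial.coeff_eq_zero_of_natDegree_lt (by omega),
      Polynomial.coeff_eq_zero_of_natDegree_lt (by rw [basePoly_natDegree]; omega)]

/-- The coefficient of `z ^ (2n+1-i)` in `p_{2n+1}` as a polynomial in the `H^{2n+1}_{2k+1}`. -/
def coeffPoly (i : ℕ) : MvPolynomial ℕ ℂ :=
  if i = 0 then 1 else if Even i then MvPolynomial.X ((i - 2) / 2) else 0

/-- The coefficients of `p_{2n+1} ^ 2` as polynomials in the `H^{2n+1}_{2k+1}`. -/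
def squarePoly (n : ℕ) (m : Fin (2 * n + 1)) : MvPolynomial ℕ ℂ :=
  ∑ ij ∈ Finset.HasAntidiagonal.antidiagonal (4 * n + 2 - 2 * (m : ℕ)),
    coeffPoly ij.1 * coeffPoly ij.2

namespace IsMultCanonical

variable {n : ℕ} {p : ℕ → H}

/-- The variable `j` stands for the coefficient of `z^(2n-1-2j)`, which is `i = 2j+2` steps below
the top. Odd `i` correspond to even powers of `z`, absent because `p_{2n+1}` is odd. -/
theorem eval_coeffPoly (hp : IsMultCanonical n p) (i : ℕ) :
    MvPolynomial.eval (fun j : ℕ => zcoeff (p (2 * n + 1)) (2 * (n : ℤ) - 1 - 2 * j))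
      (coeffPoly i) = zcoeff (p (2 * n + 1)) (2 * n + 1 - i) := by
  unfold coeffPoly
  split_ifs with h0 h1
  · rw [h0, map_one]
    simpa using (hp.1.odd_lead n le_rfl).symm
  · rw [MvPolynomial.eval_X]
    congr 1
    obtain ⟨k, rfl⟩ := h1
    omega
  · rw [map_zero]
    refine (sigma_eq_neg_iff.mp hp.sigma_base _ ?_).symm
    rw [Nat.not_even_iff_odd] at h1
    obtain ⟨k, rfl⟩ := h1
    exact ⟨n - k, by push_cast; ring⟩

/-- The power `z^(2m)` lies `4n+2-2m` steps below the leading power `z^(4n+2)` of the square, which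
explains the antidiagonal. -/
theorem eval_squarePoly (hp : IsMultCanonical n p) (m : Fin (2 * n + 1)) :
    MvPolynomial.eval (fun j : ℕ => zcoeff (p (2 * n + 1)) (2 * (n : ℤ) - 1 - 2 * j))
      (squarePoly n m) = zcoeff (p (2 * n + 1) ^ 2) (2 * m) := by
  have hm := m.2
  have h := zcoeff_mul hp.hasOrder_base.degLE hp.hasOrder_base.degLE (4 * n + 2 - 2 * (m : ℕ))
  have e : (2 * n + 1 : ℤ) + (2 * n + 1) - (4 * n + 2 - 2 * (m : ℕ) : ℕ) = 2 * (m : ℕ) := by omega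
  rw [e] at h
  rw [pow_two, h, squarePoly, map_sum]
  refine Finset.sum_congr rfl fun ij _ => ?_
  rw [map_mul, hp.eval_coeffPoly, hp.eval_coeffPoly]

theorem base_sq (hp : IsMultCanonical n p) (u : Fin (2 * n + 1) → ℂ)
    (hu : ∀ m, u m = MvPolynomial.eval
      (fun j : ℕ => zcoeff (p (2 * n + 1)) (2 * (n : ℤ) - 1 - 2 * j)) (squarePoly n m)) :
    p (2 * n + 1) ^ 2 = Polynomial.aeval lam (basePoly n u) := by
  obtain ⟨f, hf⟩ := hp.sigma_base_and_sq.2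
  have ho := hp.hasOrder_base.mul hp.hasOrder_base
  rw [← pow_two, hf] at ho
  have hf0 : f ≠ 0 := by
    rintro rfl
    exact ho.ne_zero (map_zero _)
  have hd : f.natDegree = 2 * n + 1 := by
    have := ho.unique (hasOrder_aeval_lam hf0)
    omega
  have hm : f.Monic := by
    have h1 := zcoeff_mul_top hp.hasOrder_base.degLE hp.hasOrder_base.degLE
    have h2 := hp.1.odd_lead n le_rfl
    have e : (2 * n + 1 : ℤ) + (2 * n + 1) = 2 * ((2 * n + 1 : ℕ) : ℤ) := by push_cast; ring
    rw [h2, ← pow_two, hf, e, zcoeff_aeval_lam, ← hd, mul_one] at h1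
    exact h1
  rw [hf, eq_basePoly hd hm]
  congr 2
  funext m
  rw [hu, hp.eval_squarePoly, hf, zcoeff_aeval_lam]

/-- Write the series as `a(λ) + b(λ)y`. Its canonical form has no nonnegative even powers and
`b(λ)y` is odd, so `a = 0`; leading terms give the degree of `b` and its monicity. -/
theorem exists_alpha (hp : IsMultCanonical n p) {m : ℕ} (hm : n ≤ m) :
    ∃ b : ℂ[X], b.Monic ∧ b.natDegree = m - n ∧
      p (2 * m + 1) = Polynomial.aeval lam b * p (2 * n + 1) := by
  have h1 : p (2 * m + 1) ∈ wSpan n p := mem_wSpan (odd_mem_posOrders hm)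
  rw [hp.wSpan_eq_range] at h1
  obtain ⟨⟨a, b⟩, hab⟩ := h1
  rw [pairMap_apply] at hab
  have hodd := sigma_eq_neg_iff.mp (sigma_aeval_mul hp.sigma_base b)
  have ha : a = 0 := by
    ext k
    have h2 := congrArg (fun g => zcoeff g (2 * k)) hab
    simp only [zcoeff_add, zcoeff_aeval_lam] at h2
    rw [hodd _ ⟨k, by ring⟩, hp.1.odd_pos m hm (2 * k) (by omega) (by omega)
      (Or.inl ⟨k, by ring⟩), add_zero] at h2
    simpa using h2
  rw [ha, map_zero, zero_add] at hab
  have ho : HasOrder (p (2 * m + 1)) (2 * m + 1) := by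
    simpa using hp.1.hasOrder (odd_mem_posOrders hm)
  have hb0 : b ≠ 0 := by
    rintro rfl
    rw [map_zero, zero_mul] at hab
    exact ho.ne_zero hab.symm
  have hob := hasOrder_aeval_lam hb0
  have hd : 2 * (b.natDegree : ℤ) + (2 * n + 1) = 2 * m + 1 := by
    have := hob.mul hp.hasOrder_base
    rw [hab] at this
    exact this.unique ho
  refine ⟨b, ?_, by omega, hab.symm⟩
  have h3 := zcoeff_mul_top hob.degLE hp.hasOrder_base.degLE
  rw [hab, hd, hp.1.odd_lead m hm, hp.1.odd_lead n le_rfl, zcoeff_aeval_lam, mul_one] at h3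
  exact h3.symm

/-! ### The containing point of the stratum -/

/-- Adjoin `z^(-2), …, z^(-2n)` to `W`. Multiplication by `λ` shifts this chain upwards and carries
`z^(-2)` to `1 = p_0`, so the sum stays stable. -/
theorem exists_stratum (hp : IsMultCanonical n p) :
    ∃ V ∈ stratum2 n, wSpan n p ≤ V ∧ V = wSpan n p ⊔ (V ⊓ Hminus) := by
  set N : Submodule ℂ H := Submodule.span ℂ (Set.range fun j : Fin n => zpow (-(2 * (j : ℕ) + 2)))
    with hN
  have hNfin : FiniteDimensional ℂ N := FiniteDimensional.span_of_finite ℂ (Set.finite_range _)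
  have hNm : N ≤ Hminus := by
    rw [hN, Submodule.span_le]
    rintro _ ⟨j, rfl⟩
    exact (hasOrder_zpow _).mem_Hminus_iff.mpr (by omega)
  set V := wSpan n p ⊔ N with hV
  have hWV : wSpan n p ≤ V := le_sup_left
  have hNV : N ≤ V := le_sup_right
  have hVm : V ⊓ Hminus = N := by
    rw [hV, sup_comm, sup_inf_assoc_of_le _ hNm, hp.1.wSpan_inf_Hminus, sup_bot_eq]
  have hord : orders V = S2 n := by
    let q : posOrders n ⊕ Fin n → H := Sum.elim (fun i => p i) fun j => zpow (-(2 * (j : ℕ) + 2))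
    let d : posOrders n ⊕ Fin n → ℤ := Sum.elim (fun i => (i : ℕ)) fun j => -(2 * (j : ℕ) + 2)
    have hVq : V = Submodule.span ℂ (Set.range q) := by
      rw [hV, hN, wSpan_eq_span_range, ← Submodule.span_union, Set.Sum.elim_range]
    have hd : Function.Injective d := by
      rintro (i | i) (j | j) hij
      · have : ((i : ℕ) : ℤ) = (j : ℕ) := hij
        exact congrArg Sum.inl (Subtype.ext (by exact_mod_cast this))
      · have : ((i : ℕ) : ℤ) = -(2 * (j : ℕ) + 2) := hij
        omega
      · have : -(2 * ((i : ℕ) : ℤ) + 2) = (j : ℕ) := hij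
        omega
      · have : -(2 * ((i : ℕ) : ℤ) + 2) = -(2 * (j : ℕ) + 2) := hij
        exact congrArg Sum.inr (Fin.ext (by omega))
    have hq : ∀ i, HasOrder (q i) (d i) := by
      rintro (i | j)
      · exact hp.1.hasOrder i.2
      · exact hasOrder_zpow _
    rw [hVq, orders_span_range hd hq]
    ext s
    constructor
    · rintro ⟨i | j, rfl⟩
      · rcases i.2 with h | h
        · refine Or.inl ⟨(Int.even_coe_nat _).mpr h, ?_⟩
          change -(2 * n : ℤ) ≤ ((i : ℕ) : ℤ)
          omega
        · refine Or.inr ?_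
          change (2 * n + 1 : ℤ) ≤ ((i : ℕ) : ℤ)
          omega
      · have := j.2
        refine Or.inl ⟨⟨-(j : ℕ) - 1, ?_⟩, ?_⟩
        · change -(2 * ((j : ℕ) : ℤ) + 2) = _
          ring
        · change -(2 * n : ℤ) ≤ -(2 * ((j : ℕ) : ℤ) + 2)
          omega
    · intro hs
      rcases le_or_gt 0 s with h0 | h0
      · obtain ⟨i, rfl⟩ := Int.eq_ofNat_of_zero_le h0
        have hi : i ∈ posOrders n := by
          rcases hs with h | h
          · exact Or.inl ((Int.even_coe_nat _).mp h.1)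
          · exact Or.inr (by omega)
        exact ⟨Sum.inl ⟨i, hi⟩, rfl⟩
      · rcases hs with ⟨⟨k, rfl⟩, h2⟩ | h
        · refine ⟨Sum.inr ⟨(-k - 1).toNat, by omega⟩, ?_⟩
          change -(2 * (((-k - 1).toNat : ℕ) : ℤ) + 2) = _
          omega
        · omega
  refine ⟨V, ⟨⟨⟨?_, ?_, ?_⟩, ?_⟩, hord⟩, hWV, by rw [hVm]⟩
  · refine isClosedSubspace_of_orders (b := -(2 * n)) ?_
    rw [hord]
    rintro s (h | h)
    · exact h.2
    · omega
  · have hker : (LinearMap.ker (projPlus V)).map V.subtype ≤ N := by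
      rw [← hVm]
      rintro _ ⟨v, hv, rfl⟩
      refine ⟨v.2, ?_⟩
      have h1 : projPlus V v = 0 := hv
      rwa [projPlus, LinearMap.comp_apply, Submodule.mkQ_apply, Submodule.Quotient.mk_eq_zero] at h1
    have : FiniteDimensional ℂ ((LinearMap.ker (projPlus V)).map V.subtype) :=
      Submodule.finiteDimensional_of_le hker
    exact (Submodule.equivMapOfInjective V.subtype V.injective_subtype _).symm.finiteDimensional
  · have hfin : FiniteDimensional ℂ ((H ⧸ Hminus) ⧸ LinearMap.range (projPlus (wSpan n p))) := by
      rw [FiniteDimensional, ← Module.rank_lt_aleph0_iff, hp.1.rank_quotient_range_projPlus]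
      exact Cardinal.natCast_lt_aleph0
    have hle : LinearMap.range (projPlus (wSpan n p)) ≤ LinearMap.range (projPlus V) := by
      rw [range_projPlus, range_projPlus]
      exact Submodule.map_mono hWV
    exact Module.Finite.of_surjective (Submodule.factor hle) (Submodule.factor_surjective hle)
  · intro w hw
    obtain ⟨a, ha, b, hb, rfl⟩ := Submodule.mem_sup.mp hw
    rw [mul_add]
    refine V.add_mem (hWV (hp.mul_mem_wSpan hp.lam_mem_wSpan ha)) ?_
    have : N ≤ V.comap (LinearMap.mulLeft ℂ lam) := by
      rw [hN, Submodule.span_le]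
      rintro _ ⟨j, rfl⟩
      change lam * zpow (-(2 * (j : ℕ) + 2)) ∈ V
      rw [lam, zpow_mul_zpow]
      rcases j with ⟨_ | j, hj⟩
      · apply hWV
        have e : zpow (2 + -(2 * ((0 : ℕ) : ℤ) + 2)) = p 0 := by
          rw [hp.zero_eq_one, one_eq_zpow]
          norm_num
        change zpow (2 + -(2 * ((0 : ℕ) : ℤ) + 2)) ∈ _
        rw [e]
        exact mem_wSpan (two_mul_mem_posOrders n 0)
      · apply hNV
        refine Submodule.subset_span ⟨⟨j, by omega⟩, ?_⟩
        change zpow _ = zpow _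
        congr 1
    exact this hb

/-! ### The dual space -/

/-- The elements `λ ^ (n - j) / p_{2n+1}` of the dual of `W`. -/
def dualBasis (n : ℕ) (p : ℕ → H) (j : Fin n) : H := lam ^ (n - (j : ℕ)) * (p (2 * n + 1))⁻¹

theorem hasOrder_dualBasis (hp : IsMultCanonical n p) (j : Fin n) :
    HasOrder (dualBasis n p j) (-(2 * (j : ℕ) + 1)) := by
  have h := (hasOrder_zpow (2 * (n - (j : ℕ) : ℕ))).mul hp.hasOrder_base.inv
  have hj := j.2
  have e : (2 * (n - (j : ℕ) : ℕ) : ℤ) + -(2 * n + 1) = -(2 * (j : ℕ) + 1) := by omega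
  rw [e] at h
  rw [dualBasis, lam_pow]
  exact h

/-- Multiplied by `a(λ) + b(λ)y`, the element gives an odd series plus `λ^(n-j) b(λ)`. Neither has a
constant term, the second because `j < n`. -/
theorem dualBasis_mem (hp : IsMultCanonical n p) (j : Fin n) :
    dualBasis n p j ∈ dbarCoker (wSpan n p) := by
  have hj := j.2
  refine ⟨?_, (hp.hasOrder_dualBasis j).mem_Hminus_iff.mpr (by omega)⟩
  intro w hw
  rw [hp.wSpan_eq_range] at hw
  obtain ⟨⟨a, b⟩, rfl⟩ := hw
  rw [pairMap_apply]
  have hinv : sigma (p (2 * n + 1))⁻¹ = -(p (2 * n + 1))⁻¹ := by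
    rw [map_inv₀, hp.sigma_base, inv_neg]
  have e : dualBasis n p j * (Polynomial.aeval lam a + Polynomial.aeval lam b * p (2 * n + 1)) =
      Polynomial.aeval lam (Polynomial.X ^ (n - (j : ℕ)) * a) * (p (2 * n + 1))⁻¹ +
      Polynomial.aeval lam (Polynomial.X ^ (n - (j : ℕ)) * b) := by
    have := mul_inv_cancel₀ hp.hasOrder_base.ne_zero
    simp only [dualBasis, map_mul, map_pow, Polynomial.aeval_X]
    linear_combination lam ^ (n - (j : ℕ)) * Polynomial.aeval lam b * this
  rw [e, zcoeff_add, sigma_eq_neg_iff.mp (sigma_aeval_mul hinv _) 0 (by simp), zero_add]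
  have h0 := zcoeff_aeval_lam (Polynomial.X ^ (n - (j : ℕ)) * b) 0
  rw [Polynomial.coeff_X_pow_mul', if_neg (by omega)] at h0
  simpa using h0

theorem neg_gap_injective (n : ℕ) :
    Function.Injective fun j : Fin n => -(2 * ((j : ℕ) : ℤ) + 1) := by
  intro a b h
  ext
  simp only at h
  omega

/-- If `v` has order `s` and `-s` is not a gap, then `v p_{-s}` has order `0`, contradicting the
vanishing of the pairing. -/
theorem orders_dbarCoker_subset (hp : IsMultCanonical n p) :
    orders (dbarCoker (wSpan n p)) ⊆ Set.range fun j : Fin n => -(2 * ((j : ℕ) : ℤ) + 1) := by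
  rintro s ⟨v, ⟨hv, hvm⟩, hs⟩
  have hneg := hs.mem_Hminus_iff.mp hvm
  have hnot : ∀ i ∈ posOrders n, s + (i : ℕ) ≠ 0 := by
    intro i hi h0
    have h1 := hs.mul (hp.1.hasOrder hi)
    rw [h0] at h1
    exact h1.1 (hv _ (mem_wSpan hi))
  have h2 : (-s).toNat ∈ (posOrders n)ᶜ := fun h => hnot _ h (by omega)
  rw [compl_posOrders] at h2
  obtain ⟨j, hj⟩ := h2
  simp only at hj
  exact ⟨j, by simp only; omega⟩

theorem dbarCoker_eq (hp : IsMultCanonical n p) :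
    dbarCoker (wSpan n p) = Submodule.span ℂ (Set.range (dualBasis n p)) := by
  have hle : Submodule.span ℂ (Set.range (dualBasis n p)) ≤ dbarCoker (wSpan n p) := by
    rw [Submodule.span_le]
    rintro _ ⟨j, rfl⟩
    exact hp.dualBasis_mem j
  refine le_antisymm (le_of_orders_subset hle ?_ (b := -(2 * n + 1)) ?_) hle
  · rw [orders_span_range (neg_gap_injective n) hp.hasOrder_dualBasis]
    exact hp.orders_dbarCoker_subset
  · intro s hs
    obtain ⟨j, rfl⟩ := hp.orders_dbarCoker_subset hs
    have := j.2
    simp only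
    omega

theorem finiteDimensional_dbarCoker (hp : IsMultCanonical n p) :
    FiniteDimensional ℂ (dbarCoker (wSpan n p)) := by
  rw [hp.dbarCoker_eq]
  exact FiniteDimensional.span_of_finite ℂ (Set.finite_range _)

theorem finrank_dbarCoker (hp : IsMultCanonical n p) :
    Module.finrank ℂ (dbarCoker (wSpan n p)) = n := by
  rw [hp.dbarCoker_eq, finrank_span_eq_card
    (linearIndependent_of_hasOrder (neg_gap_injective n) hp.hasOrder_dualBasis), Fintype.card_fin]

theorem orders_diff_natInt (hp : IsMultCanonical n p) : orders (wSpan n p) \ natInt = ∅ := by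
  ext s
  simp only [Set.mem_sdiff, Set.mem_empty_iff_false, iff_false, not_and, not_not]
  exact fun hs => hp.1.nonneg_of_mem_orders hs

theorem orders_dual_diff_natInt (hp : IsMultCanonical n p) :
    orders (dualSpace (wSpan n p)) \ natInt = Set.range fun j : Fin n => -(2 * ((j : ℕ) : ℤ) + 1) := by
  apply Set.Subset.antisymm
  · rintro s ⟨⟨v, hv, hs⟩, hneg⟩
    have h0 : s < 0 := not_le.mp hneg
    exact hp.orders_dbarCoker_subset ⟨v, ⟨hv, hs.mem_Hminus_iff.mpr h0⟩, hs⟩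
  · rintro _ ⟨j, rfl⟩
    refine ⟨⟨_, (hp.dualBasis_mem j).1, hp.hasOrder_dualBasis j⟩, ?_⟩
    change ¬(0 ≤ -(2 * ((j : ℕ) : ℤ) + 1))
    omega

end IsMultCanonical

/-! ### Normal forms and ideals of relations -/

open Polynomial in
/-- If `y ^ 2 = g(x)`, the elements `a(x) + b(x) y` form a subalgebra. -/
def pairSubalgebra {S : Type*} [CommRing S] [Algebra ℂ S] (x y : S) (g : ℂ[X])
    (h : y ^ 2 = aeval x g) : Subalgebra ℂ S where
  carrier := {s | ∃ a b : ℂ[X], s = aeval x a + aeval x b * y}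
  mul_mem' := by
    rintro _ _ ⟨a, b, rfl⟩ ⟨c, d, rfl⟩
    refine ⟨a * c + b * d * g, a * d + b * c, ?_⟩
    simp only [map_add, map_mul, ← h]
    ring
  add_mem' := by
    rintro _ _ ⟨a, b, rfl⟩ ⟨c, d, rfl⟩
    refine ⟨a + c, b + d, ?_⟩
    simp only [map_add]
    ring
  algebraMap_mem' := fun r => ⟨C r, 0, by simp⟩

section Pair

variable {S : Type*} [CommRing S] [Algebra ℂ S] {x y : S} {g : ℂ[X]}

theorem right_mem_pairSubalgebra (h : y ^ 2 = Polynomial.aeval x g) :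
    y ∈ pairSubalgebra x y g h := ⟨0, 1, by simp⟩

theorem left_mem_pairSubalgebra (h : y ^ 2 = Polynomial.aeval x g) :
    x ∈ pairSubalgebra x y g h := ⟨Polynomial.X, 0, by simp⟩

end Pair

/-- Modulo an ideal for which the variables lie in `pairSubalgebra`, all polynomials do. -/
theorem exists_mk_eq_pair {σ : Type*} (I : Ideal (MvPolynomial σ ℂ)) (s t : σ) (g : ℂ[X])
    (h : (Ideal.Quotient.mk I (MvPolynomial.X t)) ^ 2 =
      Polynomial.aeval (Ideal.Quotient.mk I (MvPolynomial.X s)) g)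
    (hmem : ∀ i, Ideal.Quotient.mk I (MvPolynomial.X i) ∈ pairSubalgebra _ _ g h)
    (P : MvPolynomial σ ℂ) :
    ∃ a b : ℂ[X], P - (Polynomial.aeval (MvPolynomial.X s) a +
      Polynomial.aeval (MvPolynomial.X s) b * MvPolynomial.X t) ∈ I := by
  have key : Ideal.Quotient.mk I P ∈ pairSubalgebra _ _ g h := by
    induction P using MvPolynomial.induction_on with
    | C c => exact (pairSubalgebra _ _ g h).algebraMap_mem c
    | add p q hp hq => rw [map_add]; exact add_mem hp hq
    | mul_X p i hp => rw [map_mul]; exact mul_mem hp (hmem i)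
  obtain ⟨a, b, hab⟩ := key
  refine ⟨a, b, ?_⟩
  rw [← Ideal.Quotient.eq_zero_iff_mem, map_sub, hab, map_add, map_mul]
  have e : ∀ a : ℂ[X], Ideal.Quotient.mk I (Polynomial.aeval (MvPolynomial.X s) a) =
      Polynomial.aeval (Ideal.Quotient.mk I (MvPolynomial.X s)) a := fun a =>
    (Polynomial.aeval_algHom_apply (Ideal.Quotient.mkₐ ℂ I) (MvPolynomial.X s) a).symm
  rw [e, e, sub_self]

/-- The kernel of an evaluation at a point with coordinates `λ` and an odd series `y` is any ideal
of relations modulo which all polynomials have the normal form `a(λ) + b(λ) y`. -/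
theorem ker_eq_of_normal_form {σ : Type*} {I : Ideal (MvPolynomial σ ℂ)} {s t : σ} {v : σ → H}
    (hs : v s = lam) (hσ : sigma (v t) = -v t) (h0 : v t ≠ 0)
    (hI : I ≤ RingHom.ker (MvPolynomial.aeval (R := ℂ) v))
    (hn : ∀ P : MvPolynomial σ ℂ, ∃ a b : ℂ[X], P - (Polynomial.aeval (MvPolynomial.X s) a +
      Polynomial.aeval (MvPolynomial.X s) b * MvPolynomial.X t) ∈ I) :
    RingHom.ker (MvPolynomial.aeval (R := ℂ) v) = I := by
  refine le_antisymm (fun P hP => ?_) hI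
  obtain ⟨a, b, hab⟩ := hn P
  have h1 := hI hab
  rw [RingHom.mem_ker] at h1 hP
  rw [map_sub, hP, map_add, map_mul, ← Polynomial.aeval_algHom_apply,
    ← Polynomial.aeval_algHom_apply, MvPolynomial.aeval_X, MvPolynomial.aeval_X, hs, zero_sub,
    neg_eq_zero] at h1
  obtain ⟨rfl, rfl⟩ := aeval_add_mul_eq_zero hσ h0 h1
  simpa using hab

/-! ### The coordinate ring of `p ^ 2 = g(λ)` -/

/-- The function `λ` on the curve. -/
def cX (g : ℂ[X]) : CurveRing g := Ideal.Quotient.mk _ (MvPolynomial.X 0)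

/-- The function `p` on the curve. -/
def cY (g : ℂ[X]) : CurveRing g := Ideal.Quotient.mk _ (MvPolynomial.X 1)

theorem mk_aeval (g a : ℂ[X]) :
    Ideal.Quotient.mk (Ideal.span {curveEq g}) (Polynomial.aeval (MvPolynomial.X 0) a) =
      Polynomial.aeval (cX g) a :=
  (Polynomial.aeval_algHom_apply (Ideal.Quotient.mkₐ ℂ (Ideal.span {curveEq g}))
    (MvPolynomial.X 0) a).symm

theorem cY_sq (g : ℂ[X]) : cY g ^ 2 = Polynomial.aeval (cX g) g := by
  rw [← sub_eq_zero, ← mk_aeval, cY, ← map_pow, ← map_sub, Ideal.Quotient.eq_zero_iff_mem]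
  exact Ideal.subset_span rfl

theorem curve_normal_form (g : ℂ[X]) (P : MvPolynomial (Fin 2) ℂ) :
    ∃ a b : ℂ[X], P - (Polynomial.aeval (MvPolynomial.X 0) a +
      Polynomial.aeval (MvPolynomial.X 0) b * MvPolynomial.X 1) ∈ Ideal.span {curveEq g} := by
  refine exists_mk_eq_pair _ 0 1 g (cY_sq g) ?_ P
  intro i
  fin_cases i
  · exact left_mem_pairSubalgebra (cY_sq g)
  · exact right_mem_pairSubalgebra (cY_sq g)

theorem exists_eq_pair (g : ℂ[X]) (r : CurveRing g) :
    ∃ a b : ℂ[X], r = Polynomial.aeval (cX g) a + Polynomial.aeval (cX g) b * cY g := by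
  obtain ⟨P, rfl⟩ := Ideal.Quotient.mk_surjective r
  obtain ⟨a, b, hab⟩ := curve_normal_form g P
  refine ⟨a, b, ?_⟩
  rw [← mk_aeval, ← mk_aeval, cY, ← map_mul, ← map_add]
  exact (Ideal.Quotient.eq).mpr hab

theorem curve_ker {g : ℂ[X]} {y : H} (hy : sigma y = -y) (h0 : y ≠ 0)
    (h : y ^ 2 = Polynomial.aeval lam g) :
    RingHom.ker (MvPolynomial.aeval (R := ℂ) ![lam, y]) = Ideal.span {curveEq g} := by
  refine ker_eq_of_normal_form (s := 0) (t := 1) rfl hy h0 ?_ (curve_normal_form g)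
  rw [Ideal.span_le, Set.singleton_subset_iff, SetLike.mem_coe, RingHom.mem_ker, curveEq, map_sub,
    map_pow, ← Polynomial.aeval_algHom_apply, MvPolynomial.aeval_X, MvPolynomial.aeval_X]
  exact sub_eq_zero.mpr h

section Embedding

variable {g : ℂ[X]} {y : H} (hy : sigma y = -y) (h0 : y ≠ 0) (h : y ^ 2 = Polynomial.aeval lam g)

/-- The isomorphism of the coordinate ring with the algebra of series generated by `λ`, `y`. -/
def curveEquiv : CurveRing g ≃ₐ[ℂ] (MvPolynomial.aeval (R := ℂ) ![lam, y]).range :=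
  (Ideal.quotientEquivAlgOfEq ℂ (curve_ker hy h0 h).symm).trans
    (Ideal.quotientKerEquivRange (MvPolynomial.aeval (R := ℂ) ![lam, y]))

theorem curveEquiv_mk (P : MvPolynomial (Fin 2) ℂ) :
    (curveEquiv hy h0 h (Ideal.Quotient.mk _ P) : H) = MvPolynomial.aeval ![lam, y] P := rfl

/-- The embedding of the coordinate ring into `H`. -/
def curveEmb : CurveRing g →ₐ[ℂ] H := (Subalgebra.val _).comp (curveEquiv hy h0 h).toAlgHom

theorem curveEmb_injective : Function.Injective (curveEmb hy h0 h) :=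
  Subtype.val_injective.comp (curveEquiv hy h0 h).injective

theorem curveEmb_cX : curveEmb hy h0 h (cX g) = lam := by
  change (curveEquiv hy h0 h (Ideal.Quotient.mk _ (MvPolynomial.X 0)) : H) = lam
  rw [curveEquiv_mk, MvPolynomial.aeval_X]
  rfl

theorem curveEmb_cY : curveEmb hy h0 h (cY g) = y := by
  change (curveEquiv hy h0 h (Ideal.Quotient.mk _ (MvPolynomial.X 1)) : H) = y
  rw [curveEquiv_mk, MvPolynomial.aeval_X]
  rfl

end Embedding

theorem isDomain_curveRing {g : ℂ[X]} {y : H} (hy : sigma y = -y) (h0 : y ≠ 0)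
    (h : y ^ 2 = Polynomial.aeval lam g) : IsDomain (CurveRing g) :=
  (curveEmb_injective hy h0 h).isDomain (curveEmb hy h0 h).toRingHom

theorem IsMultCanonical.toSubmodule_range {n : ℕ} {p : ℕ → H} (hp : IsMultCanonical n p)
    {f : ℂ[X]} (hf : p (2 * n + 1) ^ 2 = Polynomial.aeval lam f) :
    Subalgebra.toSubmodule (MvPolynomial.aeval (R := ℂ) ![lam, p (2 * n + 1)]).range =
      wSpan n p := by
  have hy0 := hp.hasOrder_base.ne_zero
  rw [hp.wSpan_eq_range]
  ext w
  constructor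
  · rintro ⟨P, rfl⟩
    obtain ⟨a, b, hab⟩ := curve_normal_form f P
    refine ⟨(a, b), ?_⟩
    rw [← curve_ker hp.sigma_base hy0 hf, RingHom.mem_ker, map_sub, sub_eq_zero] at hab
    rw [pairMap_apply]
    refine Eq.trans ?_ hab.symm
    rw [map_add, map_mul, ← Polynomial.aeval_algHom_apply, ← Polynomial.aeval_algHom_apply,
      MvPolynomial.aeval_X, MvPolynomial.aeval_X]
    rfl
  · rintro ⟨⟨a, b⟩, rfl⟩
    refine ⟨Polynomial.aeval (MvPolynomial.X 0) a +
      Polynomial.aeval (MvPolynomial.X 0) b * MvPolynomial.X 1, ?_⟩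
    change MvPolynomial.aeval (R := ℂ) ![lam, p (2 * n + 1)] _ = _
    rw [pairMap_apply, map_add, map_mul, ← Polynomial.aeval_algHom_apply,
      ← Polynomial.aeval_algHom_apply, MvPolynomial.aeval_X, MvPolynomial.aeval_X]
    rfl

/-- Modulo the tower ideal each higher variable is a polynomial in `λ` times the first one, so the
normal form of the base curve persists. -/
theorem IsMultCanonical.ker_towerPoint {n : ℕ} {p : ℕ → H} (hp : IsMultCanonical n p)
    {f : ℂ[X]} (hf : p (2 * n + 1) ^ 2 = Polynomial.aeval lam f) {α : ℕ → ℂ[X]}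
    (hα : ∀ m, n + 1 ≤ m → p (2 * m + 1) = Polynomial.aeval lam (α m) * p (2 * n + 1)) :
    RingHom.ker (MvPolynomial.aeval (R := ℂ) (towerPoint n p)) = towerIdeal n f α := by
  have h0 : towerPoint n p (some 0) = p (2 * n + 1) := rfl
  have hrel : (Ideal.Quotient.mk (towerIdeal n f α) (MvPolynomial.X (some 0))) ^ 2 =
      Polynomial.aeval (Ideal.Quotient.mk (towerIdeal n f α) (MvPolynomial.X none)) f := by
    have e := Polynomial.aeval_algHom_apply (Ideal.Quotient.mkₐ ℂ (towerIdeal n f α))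
      (MvPolynomial.X none) f
    refine Eq.trans ?_ e.symm
    change _ = Ideal.Quotient.mk (towerIdeal n f α) _
    rw [← map_pow, Ideal.Quotient.eq]
    exact Ideal.subset_span (Or.inl rfl)
  refine ker_eq_of_normal_form (s := none) (t := some 0) rfl (by rw [h0]; exact hp.sigma_base)
    (by rw [h0]; exact hp.hasOrder_base.ne_zero) ?_ (exists_mk_eq_pair _ none (some 0) f hrel ?_)
  · rw [towerIdeal, Ideal.span_le]
    rintro _ (rfl | ⟨j, hj, rfl⟩)
    · rw [SetLike.mem_coe, RingHom.mem_ker, map_sub, map_pow, ← Polynomial.aeval_algHom_apply,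
        MvPolynomial.aeval_X, MvPolynomial.aeval_X, h0, hf]
      exact sub_self _
    · rw [SetLike.mem_coe, RingHom.mem_ker, map_sub, map_mul, ← Polynomial.aeval_algHom_apply,
        MvPolynomial.aeval_X, MvPolynomial.aeval_X, MvPolynomial.aeval_X, h0]
      change p (2 * (n + j) + 1) - _ = 0
      rw [hα (n + j) (by omega)]
      exact sub_self _
  · rintro (_ | j)
    · exact left_mem_pairSubalgebra hrel
    · rcases Nat.eq_zero_or_pos j with rfl | hj
      · exact right_mem_pairSubalgebra hrel
      · refine ⟨0, α (n + j), ?_⟩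
        rw [map_zero, zero_add]
        have e := Polynomial.aeval_algHom_apply (Ideal.Quotient.mkₐ ℂ (towerIdeal n f α))
          (MvPolynomial.X none) (α (n + j))
        have e' : Polynomial.aeval (Ideal.Quotient.mk (towerIdeal n f α) (MvPolynomial.X none))
            (α (n + j)) = Ideal.Quotient.mk (towerIdeal n f α)
              (Polynomial.aeval (MvPolynomial.X none) (α (n + j))) := e
        rw [e', ← map_mul, Ideal.Quotient.eq]
        exact Ideal.subset_span (Or.inr ⟨j, hj, rfl⟩)

/-! ### The function fields of the tower -/

section FunctionField

variable {f a : ℂ[X]}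

/-- The map of coordinate rings `λ ↦ λ`, `p ↦ a(λ) p`. -/
def curveMap (f a : ℂ[X]) : CurveRing (a ^ 2 * f) →ₐ[ℂ] CurveRing f :=
  Ideal.Quotient.liftₐ _ (MvPolynomial.aeval ![cX f, Polynomial.aeval (cX f) a * cY f]) (by
    have hle : Ideal.span {curveEq (a ^ 2 * f)} ≤
        RingHom.ker (MvPolynomial.aeval (R := ℂ) ![cX f, Polynomial.aeval (cX f) a * cY f]) := by
      rw [Ideal.span_le, Set.singleton_subset_iff, SetLike.mem_coe, RingHom.mem_ker]
      change MvPolynomial.aeval _ (MvPolynomial.X 1 ^ 2 - Polynomial.aeval (MvPolynomial.X 0) _) = _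
      rw [map_sub, map_pow, ← Polynomial.aeval_algHom_apply, MvPolynomial.aeval_X,
        MvPolynomial.aeval_X]
      change (Polynomial.aeval (cX f) a * cY f) ^ 2 - Polynomial.aeval (cX f) (a ^ 2 * f) = 0
      rw [mul_pow, cY_sq, map_mul, map_pow, sub_self]
    exact fun P hP => hle hP)

theorem curveMap_cX : curveMap f a (cX _) = cX f := by
  change MvPolynomial.aeval (R := ℂ) ![cX f, Polynomial.aeval (cX f) a * cY f] (MvPolynomial.X 0) = _
  rw [MvPolynomial.aeval_X]
  rfl

theorem curveMap_cY : curveMap f a (cY _) = Polynomial.aeval (cX f) a * cY f := by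
  change MvPolynomial.aeval (R := ℂ) ![cX f, Polynomial.aeval (cX f) a * cY f] (MvPolynomial.X 1) = _
  rw [MvPolynomial.aeval_X]
  rfl

/-- The factor `a` lies in the conductor: `a(c + dy) = ac + d(ay)`. -/
theorem aeval_mul_mem_range (f a : ℂ[X]) (r : CurveRing f) :
    ∃ s, curveMap f a s = Polynomial.aeval (cX f) a * r := by
  obtain ⟨c, d, rfl⟩ := exists_eq_pair f r
  refine ⟨Polynomial.aeval (cX _) (a * c) + Polynomial.aeval (cX _) d * cY _, ?_⟩
  rw [map_add, map_mul (curveMap f a), ← Polynomial.aeval_algHom_apply,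
    ← Polynomial.aeval_algHom_apply, curveMap_cX, curveMap_cY, map_mul]
  ring

/-- Multiplying numerator and denominator by `a(λ)` moves any fraction into the image of `curveMap`,
so both coordinate rings have the same fraction field. Injectivity of `curveMap` is inherited from
the embedding into `H`. -/
theorem functionField_equiv {y : H} (hy : sigma y = -y) (h0 : y ≠ 0)
    (h : y ^ 2 = Polynomial.aeval lam f) (ha : a ≠ 0) :
    Nonempty (FractionRing (CurveRing f) ≃ₐ[ℂ] FractionRing (CurveRing (a ^ 2 * f))) := by
  have hd := isDomain_curveRing hy h0 h
  set y' := Polynomial.aeval lam a * y with hy'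
  have haL : Polynomial.aeval lam a ≠ 0 := fun hz => ha (aeval_lam_injective (by rw [hz, map_zero]))
  have hs' : sigma y' = -y' := sigma_aeval_mul hy a
  have h0' : y' ≠ 0 := mul_ne_zero haL h0
  have h' : y' ^ 2 = Polynomial.aeval lam (a ^ 2 * f) := by
    rw [hy', mul_pow, h, map_mul, map_pow]
  have hd' := isDomain_curveRing hs' h0' h'
  have hcomp : (curveEmb hy h0 h).comp (curveMap f a) = curveEmb hs' h0' h' := by
    refine Ideal.Quotient.algHom_ext _ (MvPolynomial.algHom_ext fun i => ?_)
    fin_cases i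
    · change curveEmb hy h0 h (curveMap f a (cX _)) = curveEmb hs' h0' h' (cX _)
      rw [curveMap_cX, curveEmb_cX, curveEmb_cX]
    · change curveEmb hy h0 h (curveMap f a (cY _)) = curveEmb hs' h0' h' (cY _)
      rw [curveMap_cY, curveEmb_cY, map_mul, ← Polynomial.aeval_algHom_apply, curveEmb_cX,
        curveEmb_cY]
  have hinj : Function.Injective (curveMap f a) := by
    have := curveEmb_injective hs' h0' h'
    rw [← hcomp, AlgHom.coe_comp] at this
    exact this.of_comp
  have haR : Polynomial.aeval (cX f) a ≠ 0 := by
    intro hz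
    apply haL
    rw [← curveEmb_cX hy h0 h, Polynomial.aeval_algHom_apply, hz, map_zero]
  let K := FractionRing (CurveRing f)
  let i : CurveRing (a ^ 2 * f) →ₐ[ℂ] K := (Algebra.ofId (CurveRing f) K).restrictScalars ℂ |>.comp
    (curveMap f a)
  let _ : Algebra (CurveRing (a ^ 2 * f)) K := i.toRingHom.toAlgebra
  have hmap : ∀ s, algebraMap (CurveRing (a ^ 2 * f)) K s =
      algebraMap (CurveRing f) K (curveMap f a s) := fun _ => rfl
  have : IsScalarTower ℂ (CurveRing (a ^ 2 * f)) K :=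
    IsScalarTower.of_algebraMap_eq fun c => (i.commutes c).symm
  have : FaithfulSMul (CurveRing (a ^ 2 * f)) K := by
    rw [faithfulSMul_iff_algebraMap_injective]
    exact (IsFractionRing.injective (CurveRing f) K).comp hinj
  have : IsFractionRing (CurveRing (a ^ 2 * f)) K := by
    refine IsFractionRing.of_field (CurveRing (a ^ 2 * f)) K fun z => ?_
    obtain ⟨r, s, hs, rfl⟩ := IsFractionRing.div_surjective (A := CurveRing f) z
    obtain ⟨r', hr'⟩ := aeval_mul_mem_range f a r
    obtain ⟨s', hs'⟩ := aeval_mul_mem_range f a s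
    refine ⟨r', s', ?_⟩
    rw [hmap, hmap, hr', hs', map_mul, map_mul, mul_div_mul_left]
    rw [Ne, FaithfulSMul.algebraMap_eq_zero_iff]
    exact haR
  exact ⟨((FractionRing.algEquiv (CurveRing (a ^ 2 * f)) K).restrictScalars ℂ).symm⟩

end FunctionField

/-! ### The coordinate ring of a smooth curve `p ^ 2 = f(λ)` is a Dedekind domain -/

theorem isIntegral_curveRing (f : ℂ[X]) (r : CurveRing f) :
    (Polynomial.aeval (R := ℂ) (cX f)).toRingHom.IsIntegralElem r := by
  let _ : Algebra ℂ[X] (CurveRing f) := (Polynomial.aeval (cX f)).toAlgebra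
  have hmap : ∀ a : ℂ[X], algebraMap ℂ[X] (CurveRing f) a = Polynomial.aeval (cX f) a :=
    fun _ => rfl
  have hY : IsIntegral ℂ[X] (cY f) := by
    refine IsIntegral.of_pow two_pos ?_
    rw [cY_sq, ← hmap]
    exact isIntegral_algebraMap
  obtain ⟨a, b, rfl⟩ := exists_eq_pair f r
  rw [← hmap, ← hmap]
  exact isIntegral_algebraMap.add (isIntegral_algebraMap.mul hY)

/-- After division by the gcd, `c'²` is coprime to `b'²` and hence divides `f`; squarefreeness makes
`c'` a unit. -/
theorem dvd_of_sq_dvd_sq_mul {f b c : ℂ[X]} (hf : Squarefree f) (hc : c ≠ 0)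
    (h : c ^ 2 ∣ b ^ 2 * f) : c ∣ b := by
  have hg0 : EuclideanDomain.gcd b c ≠ 0 := fun hz => hc (EuclideanDomain.gcd_eq_zero_iff.mp hz).2
  obtain ⟨b', hb⟩ := EuclideanDomain.gcd_dvd_left b c
  obtain ⟨c', hcc⟩ := EuclideanDomain.gcd_dvd_right b c
  set d := EuclideanDomain.gcd b c with hd
  have hcop : IsCoprime c' b' := by
    refine ⟨EuclideanDomain.gcdB b c, EuclideanDomain.gcdA b c, mul_left_cancel₀ hg0 ?_⟩
    have := EuclideanDomain.gcd_eq_gcd_ab b c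
    rw [← hd] at this
    linear_combination -this - EuclideanDomain.gcdA b c * hb - EuclideanDomain.gcdB b c * hcc
  have h1 : c' ^ 2 ∣ b' ^ 2 * f := by
    rw [hb, hcc, mul_pow, mul_pow, mul_assoc] at h
    exact (mul_dvd_mul_iff_left (pow_ne_zero 2 hg0)).mp h
  have h2 : c' * c' ∣ f := by
    rw [← pow_two]
    exact (hcop.pow (m := 2) (n := 2)).dvd_of_dvd_mul_left h1
  rw [hb, hcc]
  exact mul_dvd_mul_left d (hf c' h2).dvd

/-- The series `T` is the rational function `a/c` in `λ`, and `ℂ[λ]` is integrally closed. -/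
theorem dvd_of_isIntegral {a c : ℂ[X]} {T : H} (hc : c ≠ 0)
    (hT : (Polynomial.aeval (R := ℂ) lam).toRingHom.IsIntegralElem T)
    (h : Polynomial.aeval lam c * T = Polynomial.aeval lam a) : c ∣ a := by
  let _ : Algebra ℂ[X] H := (Polynomial.aeval (R := ℂ) lam).toAlgebra
  have hinj : Function.Injective (Algebra.ofId ℂ[X] H) := aeval_lam_injective
  let ψ : FractionRing ℂ[X] →ₐ[ℂ[X]] H := IsFractionRing.liftAlgHom hinj
  have hψ : ∀ a : ℂ[X], ψ (algebraMap _ _ a) = Polynomial.aeval lam a := fun a => ψ.commutes a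
  have hcL : Polynomial.aeval lam c ≠ 0 := fun hz => hc (aeval_lam_injective (by rw [hz, map_zero]))
  have hTψ : ψ (algebraMap _ _ a / algebraMap _ _ c) = T := by
    rw [map_div₀, hψ, hψ, ← h, mul_div_cancel_left₀ _ hcL]
  have hint : IsIntegral ℂ[X] (algebraMap ℂ[X] (FractionRing ℂ[X]) a / algebraMap _ _ c) := by
    rw [← isIntegral_algHom_iff ψ ψ.toRingHom.injective, hTψ]
    exact hT
  obtain ⟨t, ht⟩ := IsIntegrallyClosed.algebraMap_eq_of_integral hint
  refine ⟨t, aeval_lam_injective ?_⟩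
  rw [map_mul, ← h, ← hTψ, ← ht, hψ]

section Dedekind

variable {f : ℂ[X]} {Y : H} (hy : sigma Y = -Y) (h0 : Y ≠ 0) (h : Y ^ 2 = Polynomial.aeval lam f)

theorem curveEmb_pair (a b : ℂ[X]) : curveEmb hy h0 h (Polynomial.aeval (cX f) a +
    Polynomial.aeval (cX f) b * cY f) = Polynomial.aeval lam a + Polynomial.aeval lam b * Y := by
  rw [map_add, map_mul, ← Polynomial.aeval_algHom_apply, ← Polynomial.aeval_algHom_apply,
    curveEmb_cX, curveEmb_cY]

/-- Integrality over `ℂ[λ]` bounds the dimension. For normality, an integral fraction is compared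
with its conjugate under `sigma`: the sum and the squared difference are integral over `ℂ[λ]` and
rational in `λ`. -/
theorem isDedekindDomain_curveRing (hy : sigma Y = -Y) (h0 : Y ≠ 0)
    (h : Y ^ 2 = Polynomial.aeval lam f) (hf : Squarefree f) : IsDedekindDomain (CurveRing f) := by
  have hdom := isDomain_curveRing hy h0 h
  let _ : Algebra ℂ[X] (CurveRing f) := (Polynomial.aeval (cX f)).toAlgebra
  have hintR : Algebra.IsIntegral ℂ[X] (CurveRing f) := ⟨isIntegral_curveRing f⟩
  have hdim : Ring.DimensionLEOne (CurveRing f) := by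
    refine ⟨fun {P} hP hPp => ?_⟩
    obtain ⟨r, hr, hr0⟩ := Submodule.exists_mem_ne_zero_of_ne_bot hP
    have h1 : P.comap (algebraMap ℂ[X] (CurveRing f)) ≠ ⊥ :=
      Ideal.comap_ne_bot_of_integral_mem hr0 hr (isIntegral_curveRing f r)
    have h2 : (P.comap (algebraMap ℂ[X] (CurveRing f))).IsPrime := Ideal.IsPrime.comap _
    exact Ideal.isMaximal_of_isIntegral_of_isMaximal_comap P (h2.isMaximal h1)
  have hcl : IsIntegrallyClosed (CurveRing f) := by
    let F := FractionRing (CurveRing f)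
    rw [isIntegrallyClosed_iff F]
    intro g hg
    let _ : Algebra ℂ[X] H := (Polynomial.aeval (R := ℂ) lam).toAlgebra
    let ι := curveEmb hy h0 h
    let _ : Algebra (CurveRing f) H := ι.toRingHom.toAlgebra
    have hinj : Function.Injective (Algebra.ofId (CurveRing f) H) := curveEmb_injective hy h0 h
    have : IsScalarTower (CurveRing f) (CurveRing f) H :=
      ⟨fun a b c => mul_smul a b c⟩
    let φ : F →ₐ[CurveRing f] H := IsFractionRing.liftAlgHom hinj
    have htower : IsScalarTower ℂ[X] (CurveRing f) H := by
      refine IsScalarTower.of_algebraMap_eq fun a => ?_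
      change Polynomial.aeval lam a = ι (Polynomial.aeval (cX f) a)
      rw [← Polynomial.aeval_algHom_apply, curveEmb_cX]
    have hG : IsIntegral ℂ[X] (φ g) := isIntegral_trans (A := CurveRing f) _ (hg.map φ)
    let τ : H →ₐ[ℂ[X]] H := { sigma with commutes' := sigma_aeval_lam }
    have hG' : IsIntegral ℂ[X] (sigma (φ g)) := hG.map τ
    obtain ⟨r, s, hs, hrs⟩ := IsFractionRing.div_surjective (A := CurveRing f) g
    obtain ⟨a, b, hab⟩ := exists_eq_pair f r
    obtain ⟨c, d, hcd⟩ := exists_eq_pair f s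
    have hs0 : ι s ≠ 0 := fun hz => nonZeroDivisors.ne_zero hs
      (curveEmb_injective hy h0 h (by rw [map_zero]; exact hz))
    have hGrs : ι s * φ g = ι r := by
      have e : φ g = ι r / ι s := by
        rw [← hrs, map_div₀]
        exact congrArg₂ _ (φ.commutes r) (φ.commutes s)
      rw [e, mul_div_cancel₀ _ hs0]
    have hιr : ι r = _ := (congrArg ι hab).trans (curveEmb_pair hy h0 h a b)
    have hιs : ι s = _ := (congrArg ι hcd).trans (curveEmb_pair hy h0 h c d)
    have hbar : Polynomial.aeval lam c - Polynomial.aeval lam d * Y ≠ 0 := by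
      intro hz
      obtain ⟨rfl, h2⟩ := aeval_add_mul_eq_zero hy h0 (a := c) (b := -d) (by
        rw [map_neg]; linear_combination hz)
      obtain rfl : d = 0 := neg_eq_zero.mp h2
      apply hs0
      rw [hιs]
      simp
    -- The norm of the denominator `s`; with it the fraction becomes `(a' + b'y)/n`.
    set n : ℂ[X] := c ^ 2 - d ^ 2 * f with hn
    have hnL : Polynomial.aeval lam n = ι s * (Polynomial.aeval lam c - Polynomial.aeval lam d * Y) := by
      rw [hιs, hn]
      simp only [map_sub, map_mul, map_pow]
      rw [← h]
      ring
    have hn0 : n ≠ 0 := by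
      intro hz
      rw [hz, map_zero] at hnL
      exact mul_ne_zero hs0 hbar hnL.symm
    set a' : ℂ[X] := a * c - b * d * f with ha'
    set b' : ℂ[X] := b * c - a * d with hb'
    have hnG : Polynomial.aeval lam n * φ g =
        Polynomial.aeval lam a' + Polynomial.aeval lam b' * Y := by
      rw [hnL, mul_right_comm, hGrs, hιr, ha', hb']
      simp only [map_sub, map_mul]
      rw [← h]
      ring
    have hnG' : Polynomial.aeval lam n * sigma (φ g) =
        Polynomial.aeval lam a' - Polynomial.aeval lam b' * Y := by
      have := congrArg sigma hnG
      rwa [map_mul, map_add, map_mul, sigma_aeval_lam, sigma_aeval_lam, sigma_aeval_lam, hy,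
        mul_neg, ← sub_eq_add_neg] at this
    have d1 : n ∣ 2 * a' := by
      refine dvd_of_isIntegral hn0 (hG.add hG') ?_
      rw [mul_add, hnG, hnG', map_mul, map_ofNat]
      ring
    -- The squared difference of the conjugates is `(2b')² f / n²`; `f` being squarefree, this
    -- yields `n ∣ 2b'`.
    have d2 : n ^ 2 ∣ (2 * b') ^ 2 * f := by
      refine dvd_of_isIntegral (pow_ne_zero 2 hn0) ((hG.sub hG').pow 2) ?_
      rw [map_mul, map_pow, map_pow, map_mul, map_ofNat, ← h, ← mul_pow, mul_sub, hnG, hnG']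
      ring
    have h2u : IsUnit (2 : ℂ[X]) := by
      have : (2 : ℂ[X]) = Polynomial.C 2 := by rw [map_ofNat]
      rw [this, Polynomial.isUnit_C]
      exact isUnit_iff_ne_zero.mpr two_ne_zero
    obtain ⟨a'', ha''⟩ := (h2u.dvd_mul_left).mp d1
    obtain ⟨b'', hb''⟩ := (h2u.dvd_mul_left).mp (dvd_of_sq_dvd_sq_mul hf hn0 d2)
    refine ⟨Polynomial.aeval (cX f) a'' + Polynomial.aeval (cX f) b'' * cY f,
      φ.toRingHom.injective ?_⟩
    refine (φ.commutes _).trans ((curveEmb_pair hy h0 h a'' b'').trans ?_)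
    have hnn : Polynomial.aeval lam n ≠ 0 := by
      rw [hnL]
      exact mul_ne_zero hs0 hbar
    apply mul_left_cancel₀ hnn
    refine Eq.trans ?_ hnG.symm
    rw [ha'', hb'', map_mul, map_mul]
    ring
  have hnoeth : IsNoetherianRing (CurveRing f) := inferInstance
  have : IsDedekindRing (CurveRing f) := (isDedekindRing_iff (CurveRing f)
    (FractionRing (CurveRing f))).mpr ⟨hnoeth, hdim, (isIntegrallyClosed_iff _).mp hcl⟩
  exact {}

end Dedekind

open KaehlerDifferential

/-! ### Differentials on the function field -/

section Differentials

variable {F : Type} [Field F] [Algebra ℂ F] {x y : F} {f : ℂ[X]}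

/-- The differential `dx / y`. -/
def eta (x y : F) : Ω[F⁄ℂ] := y⁻¹ • D ℂ F x

theorem smul_eta (hy : y ≠ 0) : y • eta x y = D ℂ F x := by
  rw [eta, smul_smul, mul_inv_cancel₀ hy, one_smul]

/-- Differentiate the equation of the curve, `2y dy = f'(x) dx`, and cancel `y`. -/
theorem two_smul_D_right (hy : y ≠ 0) (h : y ^ 2 = Polynomial.aeval x f) :
    (2 : F) • D ℂ F y = Polynomial.aeval x (Polynomial.derivative f) • eta x y := by
  have h1 := congrArg (D ℂ F) h
  rw [Derivation.map_aeval, pow_two, Derivation.leibniz] at h1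
  apply smul_right_injective _ hy
  change y • (2 : F) • D ℂ F y = y • _ • eta x y
  rw [smul_comm y (Polynomial.aeval x _), smul_eta hy, ← h1, smul_smul, mul_two, add_smul]

/-- The differential of a polynomial function is a polynomial multiple of `dx / y`. -/
theorem exists_D_pair (hy : y ≠ 0) (h : y ^ 2 = Polynomial.aeval x f) (a b : ℂ[X]) :
    ∃ c d : ℂ[X], D ℂ F (Polynomial.aeval x a + Polynomial.aeval x b * y) =
      (Polynomial.aeval x c + Polynomial.aeval x d * y) • eta x y := by
  refine ⟨Polynomial.derivative b * f + Polynomial.C (1 / 2) * b * Polynomial.derivative f,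
    Polynomial.derivative a, ?_⟩
  have h2 : D ℂ F y = (algebraMap ℂ F (1 / 2) * Polynomial.aeval x (Polynomial.derivative f)) •
      eta x y := by
    rw [mul_smul, ← two_smul_D_right hy h, smul_smul]
    have : algebraMap ℂ F (1 / 2) * 2 = 1 := by
      rw [show (2 : F) = algebraMap ℂ F 2 by rw [map_ofNat], ← map_mul]
      norm_num
    rw [this, one_smul]
  rw [map_add, Derivation.leibniz, Derivation.map_aeval, Derivation.map_aeval, h2, ← smul_eta hy,
    smul_smul, smul_smul, smul_smul, smul_smul, ← add_smul, ← add_smul]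
  congr 1
  simp only [map_add, map_mul, Polynomial.aeval_C, ← h]
  ring

/-- The quotient rule with the coefficient kept explicit, so that its membership in a valuation ring
can be read off when `s` is a unit there. -/
theorem D_of_mul_eq {r s g r' s' : F} {ω : Ω[F⁄ℂ]} (hs : s ≠ 0) (hg : g * s = r)
    (hr : D ℂ F r = r' • ω) (hs' : D ℂ F s = s' • ω) : D ℂ F g = (s⁻¹ * (r' - g * s')) • ω := by
  have h1 := congrArg (D ℂ F) hg
  rw [Derivation.leibniz, hr, hs', smul_smul] at h1
  have h2 : s • D ℂ F g = (r' - g * s') • ω := by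
    rw [sub_smul, ← h1, add_sub_cancel_left]
  rw [mul_smul, ← h2, smul_smul, inv_mul_cancel₀ hs, one_smul]

/-- The elements of a valuation ring over `ℂ`, as a subalgebra. -/
def valuationSubalgebra (A : ValuationSubring F) (hA : ∀ c : ℂ, algebraMap ℂ F c ∈ A) :
    Subalgebra ℂ F := { A.toSubring with algebraMap_mem' := hA }

theorem aeval_mem_valuationSubring {A : ValuationSubring F} (hA : ∀ c : ℂ, algebraMap ℂ F c ∈ A)
    (hx : x ∈ A) (a : ℂ[X]) : Polynomial.aeval x a ∈ A := by
  have h := Algebra.adjoin_le (S := valuationSubalgebra A hA) (s := {x})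
    (Set.singleton_subset_iff.mpr hx)
  exact h (Polynomial.aeval_mem_adjoin_singleton ℂ x)

theorem sq_mem_valuationSubring {F : Type*} [Field F] {A : ValuationSubring F} {y : F}
    (h : y ^ 2 ∈ A) : y ∈ A := by
  rw [← A.valuation_le_one_iff, map_pow] at h
  rw [← A.valuation_le_one_iff]
  exact (pow_le_one_iff_of_nonneg zero_le two_ne_zero).mp h

theorem smul_D_mem_span {A : ValuationSubring F} {a g : F} (ha : a ∈ A) (hg : g ∈ A) :
    a • D ℂ F g ∈ Submodule.span A (D ℂ F '' (A : Set F)) :=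
  Submodule.smul_mem _ (⟨a, ha⟩ : A) (Submodule.subset_span ⟨g, hg, rfl⟩)

/-- `x ^ i dx / y` is regular at the finite places. -/
theorem pow_smul_eta_mem_of_mem (hy : y ≠ 0) (h : y ^ 2 = Polynomial.aeval x f)
    (hf : Squarefree f) {A : ValuationSubring F} (hA : ∀ c : ℂ, algebraMap ℂ F c ∈ A)
    (hx : x ∈ A) (i : ℕ) : x ^ i • eta x y ∈ Submodule.span A (D ℂ F '' (A : Set F)) := by
  have hyA : y ∈ A := sq_mem_valuationSubring (by
    rw [h]
    exact aeval_mem_valuationSubring hA hx f)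
  -- From `u f + v f' = 1` follows `dx/y = u y dx + 2v dy`, which has no denominator.
  obtain ⟨u, v, huv⟩ := PerfectField.separable_iff_squarefree.mpr hf
  have h1 : Polynomial.aeval x u * y ^ 2 +
      Polynomial.aeval x v * Polynomial.aeval x (Polynomial.derivative f) = 1 := by
    rw [h, ← map_mul, ← map_mul, ← map_add, huv, map_one]
  have e : x ^ i • eta x y = (x ^ i * Polynomial.aeval x u * y) • D ℂ F x +
      (x ^ i * Polynomial.aeval x v * 2) • D ℂ F y := by
    rw [mul_smul _ (2 : F), two_smul_D_right hy h, ← smul_eta hy, smul_smul, smul_smul, ← add_smul]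
    congr 1
    linear_combination -x ^ i * h1
  rw [e]
  have hu := aeval_mem_valuationSubring hA hx u
  have hv := aeval_mem_valuationSubring hA hx v
  have hxi := pow_mem hx i
  have h2 : (2 : F) ∈ A := by
    have := hA 2
    rwa [map_ofNat] at this
  exact Submodule.add_mem _ (smul_D_mem_span (mul_mem (mul_mem hxi hu) hyA) hx)
    (smul_D_mem_span (mul_mem (mul_mem hxi hv) h2) hyA)

/-- `x ^ i dx / y`, `i < n`, is regular at infinity. -/
theorem pow_smul_eta_mem_of_notMem {n : ℕ} (hy : y ≠ 0) (h : y ^ 2 = Polynomial.aeval x f)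
    (hm : f.Monic) (hd : f.natDegree = 2 * n + 1) {A : ValuationSubring F}
    (hA : ∀ c : ℂ, algebraMap ℂ F c ∈ A) (hx : x ∉ A) {i : ℕ} (hi : i < n) :
    x ^ i • eta x y ∈ Submodule.span A (D ℂ F '' (A : Set F)) := by
  have hx0 : x ≠ 0 := fun hz => hx (hz ▸ A.zero_mem)
  set X := x⁻¹ with hX
  have hvX : A.valuation X < 1 := by
    rw [← A.valuation_le_one_iff, not_le, A.valuation.one_lt_val_iff hx0] at hx
    exact hx
  have hXA : X ∈ A := (A.valuation_le_one_iff X).mp hvX.le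
  -- In terms of `X = 1/x`, `y² = x^(2n+1) G` with `G = P(X)`; `G` is a unit at this place because
  -- `f` is monic.
  set P := f.reverse with hP
  set G := Polynomial.aeval X P with hG
  have hGeq : G * x ^ (2 * n + 1) = y ^ 2 := by
    let _ : Invertible x := invertibleOfNonzero hx0
    have := Polynomial.eval₂_reverse_mul_pow (algebraMap ℂ F) x f
    rw [hd, invOf_eq_inv] at this
    rw [h]
    exact this
  have hG1 : G = 1 + X * Polynomial.aeval X P.divX := by
    have h0 : P.coeff 0 = 1 := by rw [hP, Polynomial.coeff_zero_reverse, hm.leadingCoeff]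
    have h1 := congrArg (Polynomial.aeval X) (Polynomial.divX_mul_X_add P)
    rw [h0, map_add, map_mul, Polynomial.aeval_X, map_one, map_one] at h1
    rw [hG, ← h1]
    ring
  have hvG : A.valuation G = 1 := by
    rw [hG1]
    apply Valuation.map_one_add_of_lt
    rw [map_mul]
    exact mul_lt_one_of_lt_of_le hvX
      ((A.valuation_le_one_iff _).mpr (aeval_mem_valuationSubring hA hXA _))
  -- The parameter at infinity: `t² G = X`.
  set t := x ^ n * y⁻¹ with ht
  have htG : t ^ 2 * G = X := by
    have e : t ^ 2 * G * (x ^ (2 * n + 1)) = X * x ^ (2 * n + 1) := by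
      rw [mul_assoc, hGeq, ht, hX]
      field_simp
      ring
    exact mul_right_cancel₀ (pow_ne_zero _ hx0) e
  have hvt : A.valuation (t ^ 2) < 1 := by
    have := congrArg A.valuation htG
    rw [map_mul, hvG, mul_one] at this
    rw [this]
    exact hvX
  have htA : t ∈ A := sq_mem_valuationSubring ((A.valuation_le_one_iff _).mp hvt.le)
  set P' := Polynomial.aeval X (Polynomial.derivative P) with hP'
  -- Differentiating `t² G = X` gives `e dX = 2tG dt`, and `e` is a unit since `t² P'` has valuation
  -- below `1`.
  set e := 1 + -(t ^ 2 * P') with he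
  have hve : A.valuation e = 1 := by
    apply Valuation.map_one_add_of_lt
    rw [Valuation.map_neg, map_mul]
    exact mul_lt_one_of_lt_of_le hvt
      ((A.valuation_le_one_iff _).mpr (aeval_mem_valuationSubring hA hXA _))
  have he0 : e ≠ 0 := by
    intro hz
    rw [hz, map_zero] at hve
    exact zero_ne_one hve
  have heA : e⁻¹ ∈ A := by
    rw [← A.valuation_le_one_iff, map_inv₀, hve, inv_one]
  have hDX : e • D ℂ F X = (2 * t * G) • D ℂ F t := by
    have h1 := congrArg (D ℂ F) htG
    rw [Derivation.leibniz, hG, Derivation.map_aeval, ← hG, ← hP', pow_two, Derivation.leibniz] at h1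
    have h2 : e • D ℂ F X = D ℂ F X - (t * t) • P' • D ℂ F X := by
      rw [he, add_smul, one_smul, neg_smul, ← sub_eq_add_neg, mul_smul, pow_two]
    rw [h2, sub_eq_iff_eq_add]
    refine h1.symm.trans ?_
    rw [add_comm, ← add_smul, smul_smul]
    congr 2
    ring
  have hDX' : D ℂ F X = (e⁻¹ * (2 * t * G)) • D ℂ F t := by
    rw [mul_smul, ← hDX, smul_smul, inv_mul_cancel₀ he0, one_smul]
  have hDx : D ℂ F x = -x ^ 2 • D ℂ F X :=
    (D ℂ F).leibniz_of_mul_eq_one (mul_inv_cancel₀ hx0)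
  -- The exponent `n-1-i` is a true difference exactly because `i < n`.
  have key : x ^ i • eta x y = (-2 * e⁻¹ * X ^ (n - 1 - i)) • D ℂ F t := by
    rw [eta, hDx, hDX', smul_smul, smul_smul, smul_smul]
    congr 1
    have e1 : x ^ i * X ^ i = 1 := by rw [← mul_pow, mul_inv_cancel₀ hx0, one_pow]
    have e2 : y⁻¹ = t * X ^ n := by
      rw [ht, mul_right_comm, ← mul_pow, mul_inv_cancel₀ hx0, one_pow, one_mul]
    have e3 : X ^ n = X ^ (n - 1 - i) * X ^ i * X := by
      rw [← pow_add, ← pow_succ]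
      congr 1
      omega
    have e4 : x * X = 1 := mul_inv_cancel₀ hx0
    rw [e2, e3]
    calc x ^ i * (t * (X ^ (n - 1 - i) * X ^ i * X)) * -x ^ 2 * (e⁻¹ * (2 * t * G))
        = -2 * e⁻¹ * X ^ (n - 1 - i) * (x ^ i * X ^ i) * (x * X) * x * (t ^ 2 * G) := by ring
      _ = _ := by rw [e1, e4, htG, mul_one, mul_one, mul_assoc _ x, e4, mul_one]
  rw [key]
  refine smul_D_mem_span (mul_mem (mul_mem ?_ heA) (pow_mem hXA _)) htA
  have := hA (-2)
  rwa [map_neg, map_ofNat] at this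

end Differentials

/-! ### The place at infinity -/

theorem inv_degLE_zero {g : H} (hg : ¬DegLE g 0) : DegLE g⁻¹ 0 := by
  have h0 : g ≠ 0 := by
    rintro rfl
    exact hg fun k _ => zcoeff_zero k
  obtain ⟨s, hs⟩ := exists_hasOrder h0
  have : 0 < s := by
    by_contra hn
    exact hg (hs.degLE.mono (by omega))
  exact hs.inv.degLE.mono (by omega)

theorem degLE_add {g g' : H} {a : ℤ} (h : DegLE g a) (h' : DegLE g' a) : DegLE (g + g') a :=
  fun k hk => by rw [zcoeff_add, h k hk, h' k hk, add_zero]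

/-- The series without positive powers of `z`. -/
def infinityRing : ValuationSubring H where
  carrier := {g | DegLE g 0}
  mul_mem' := fun ha hb => by simpa using DegLE.mul ha hb
  one_mem' := by
    rw [one_eq_zpow]
    exact (hasOrder_zpow 0).degLE
  add_mem' := fun ha hb => degLE_add ha hb
  zero_mem' := fun k _ => zcoeff_zero k
  neg_mem' := fun ha k hk => by rw [zcoeff_neg, ha k hk, neg_zero]
  mem_or_inv_mem' := fun g => or_iff_not_imp_left.mpr inv_degLE_zero

/-- The derivation `z d/dz` kills the constant term. -/
theorem theta_mem_Hminus {g : H} (hg : DegLE g 0) : DegLE (theta g) (-1) := by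
  intro k hk
  rw [zcoeff_theta]
  rcases eq_or_lt_of_le (show 0 ≤ k by omega) with rfl | h
  · simp
  · rw [hg k h, mul_zero]

theorem algebraMap_degLE (c : ℂ) : DegLE (algebraMap ℂ H c) 0 := by
  intro k hk
  rw [Algebra.algebraMap_eq_smul_one, zcoeff_smul, zcoeff_one, if_neg (by omega), mul_zero]

section Infinity

variable {F : Type} [Field F] [Algebra ℂ F]

/-- An embedding of `F` into `H` turns `z d/dz` into an additive map on differentials. -/
theorem exists_residue (φ : F →ₐ[ℂ] H) :
    ∃ L : Ω[F⁄ℂ] →ₗ[ℂ] H, (∀ g, L (D ℂ F g) = theta (φ g)) ∧ ∀ a ω, L (a • ω) = φ a * L ω := by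
  let _ : Algebra F H := φ.toRingHom.toAlgebra
  have : IsScalarTower ℂ F H := IsScalarTower.of_algebraMap_eq fun c => (φ.commutes c).symm
  let δ : Derivation ℂ F H := theta.compAlgebraMap F
  exact ⟨δ.liftKaehlerDifferential.restrictScalars ℂ,
    fun g => δ.liftKaehlerDifferential_comp_D g, fun a ω => δ.liftKaehlerDifferential.map_smul a ω⟩

/-- Regularity is used at a single place, the pullback of `infinityRing` under the embedding. -/
theorem degLE_of_mem_span {φ : F →ₐ[ℂ] H} {L : Ω[F⁄ℂ] →ₗ[ℂ] H}
    (hL : ∀ g, L (D ℂ F g) = theta (φ g)) (hL' : ∀ a ω, L (a • ω) = φ a * L ω) {ω : Ω[F⁄ℂ]}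
    (hω : ω ∈ regularDifferentials F) : DegLE (L ω) (-1) := by
  have h := hω (infinityRing.comap φ.toRingHom) (fun c => by
    change DegLE (φ (algebraMap ℂ F c)) 0
    rw [φ.commutes]
    exact algebraMap_degLE c)
  clear hω
  induction h using Submodule.span_induction with
  | mem x hx =>
    obtain ⟨g, hg, rfl⟩ := hx
    rw [hL]
    exact theta_mem_Hminus hg
  | zero =>
    rw [map_zero]
    exact fun k _ => zcoeff_zero k
  | add x y _ _ hx hy =>
    rw [map_add]
    exact degLE_add hx hy
  | smul a x _ hx =>
    have e : a • x = (a : F) • x := rfl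
    rw [e, hL']
    have ha : DegLE (φ a) 0 := a.2
    simpa using ha.mul hx

end Infinity

open KaehlerDifferential IsDedekindDomain

/-! ### The genus -/

section Genus

variable {f : ℂ[X]} {F : Type} [Field F] [Algebra ℂ F] [Algebra (CurveRing f) F]
  [IsScalarTower ℂ (CurveRing f) F]

theorem algebraMap_cY_sq (f : ℂ[X]) (F : Type) [Field F] [Algebra ℂ F] [Algebra (CurveRing f) F]
    [IsScalarTower ℂ (CurveRing f) F] : (algebraMap (CurveRing f) F (cY f)) ^ 2 =
      Polynomial.aeval (algebraMap (CurveRing f) F (cX f)) f := by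
  rw [← map_pow, cY_sq, Polynomial.aeval_algebraMap_apply]

theorem exists_D_algebraMap (hy : algebraMap (CurveRing f) F (cY f) ≠ 0) (r : CurveRing f) :
    ∃ s : CurveRing f, D ℂ F (algebraMap (CurveRing f) F r) = algebraMap (CurveRing f) F s •
      eta (algebraMap (CurveRing f) F (cX f)) (algebraMap (CurveRing f) F (cY f)) := by
  obtain ⟨a, b, rfl⟩ := exists_eq_pair f r
  obtain ⟨c, d, hcd⟩ := exists_D_pair hy (algebraMap_cY_sq f F) a b
  refine ⟨Polynomial.aeval (cX f) c + Polynomial.aeval (cX f) d * cY f, ?_⟩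
  simp only [Polynomial.aeval_algebraMap_apply] at hcd
  simp only [map_add (algebraMap (CurveRing f) F), map_mul (algebraMap (CurveRing f) F)]
  exact hcd

variable [IsFractionRing (CurveRing f) F]

theorem exists_eq_smul_eta [IsDomain (CurveRing f)] (hy : algebraMap (CurveRing f) F (cY f) ≠ 0)
    (ω : Ω[F⁄ℂ]) : ∃ g : F, ω = g •
      eta (algebraMap (CurveRing f) F (cX f)) (algebraMap (CurveRing f) F (cY f)) := by
  have h : ω ∈ Submodule.span F (Set.range (D ℂ F)) := by
    rw [span_range_derivation]
    exact Submodule.mem_top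
  induction h using Submodule.span_induction with
  | mem x hx =>
    obtain ⟨g, rfl⟩ := hx
    obtain ⟨r, s, hs, rfl⟩ := IsFractionRing.div_surjective (A := CurveRing f) g
    have hs0 : algebraMap (CurveRing f) F s ≠ 0 :=
      IsFractionRing.to_map_ne_zero_of_mem_nonZeroDivisors hs
    obtain ⟨r', hr'⟩ := exists_D_algebraMap hy r
    obtain ⟨s', hs'⟩ := exists_D_algebraMap hy s
    exact ⟨_, D_of_mul_eq hs0 (div_mul_cancel₀ _ hs0) hr' hs'⟩
  | zero => exact ⟨0, (zero_smul _ _).symm⟩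
  | add x y _ _ hx hy =>
    obtain ⟨a, rfl⟩ := hx
    obtain ⟨b, rfl⟩ := hy
    exact ⟨a + b, (add_smul _ _ _).symm⟩
  | smul c x _ hx =>
    obtain ⟨a, rfl⟩ := hx
    exact ⟨c * a, smul_smul _ _ _⟩

/-- A differential `g dx / y` that is regular at all finite places has `g` in the coordinate
ring. -/
theorem mem_range_of_regular [IsDedekindDomain (CurveRing f)]
    (hy : algebraMap (CurveRing f) F (cY f) ≠ 0)
    (hη : eta (algebraMap (CurveRing f) F (cX f)) (algebraMap (CurveRing f) F (cY f)) ≠ 0) {g : F}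
    (hg : g • eta (algebraMap (CurveRing f) F (cX f)) (algebraMap (CurveRing f) F (cY f)) ∈
      regularDifferentials F) : g ∈ (algebraMap (CurveRing f) F).range := by
  refine HeightOneSpectrum.mem_integers_of_valuation_le_one F g fun v => ?_
  set A := (v.valuation F).valuationSubring with hA
  have hRA : ∀ r : CurveRing f, algebraMap (CurveRing f) F r ∈ A := fun r => v.valuation_le_one r
  have h := hg A fun c => by
    rw [IsScalarTower.algebraMap_apply ℂ (CurveRing f) F]
    exact hRA _
  -- Write an element of `A` as `r/s` with `s` outside the prime. The quotient rule makes its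
  -- differential an `A`-multiple of `dx/y`, so `g dx/y` regular at `v` forces `g ∈ A`.
  have hle : Submodule.span A (D ℂ F '' (A : Set F)) ≤ Submodule.span A
      {eta (algebraMap (CurveRing f) F (cX f)) (algebraMap (CurveRing f) F (cY f))} := by
    rw [Submodule.span_le]
    rintro _ ⟨a, ha, rfl⟩
    obtain ⟨r, s, hrs⟩ := v.exists_primeCompl_mul_eq_of_integer a ha
    have hvs : v.valuation F (algebraMap (CurveRing f) F s) = 1 := v.valuation_eq_one_iff_notMem.mpr s.2
    have hs0 : algebraMap (CurveRing f) F s ≠ 0 := by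
      intro hz
      rw [hz, map_zero] at hvs
      exact zero_ne_one hvs
    have hsA : (algebraMap (CurveRing f) F s)⁻¹ ∈ A := by
      change v.valuation F _ ≤ 1
      rw [map_inv₀, hvs, inv_one]
    obtain ⟨r', hr'⟩ := exists_D_algebraMap hy r
    obtain ⟨s', hs'⟩ := exists_D_algebraMap hy (s : CurveRing f)
    rw [D_of_mul_eq hs0 hrs hr' hs']
    exact Submodule.mem_span_singleton.mpr
      ⟨⟨_, mul_mem hsA (sub_mem (hRA r') (mul_mem ha (hRA s')))⟩, rfl⟩
  obtain ⟨a, ha⟩ := Submodule.mem_span_singleton.mp (hle h)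
  have hag : (a : F) = g := smul_left_injective F hη ha
  rw [← hag]
  exact a.2

/-- Formulated for any fraction field `F` of the base coordinate ring, so that it applies verbatim
to the function fields of the tower. -/
theorem rank_regularDifferentials {n : ℕ} {Y : H} (hy : sigma Y = -Y)
    (hY : HasOrder Y (2 * n + 1)) (h : Y ^ 2 = Polynomial.aeval lam f) (hf : Squarefree f)
    (hm : f.Monic) (hd : f.natDegree = 2 * n + 1) :
    Module.rank ℂ (regularDifferentials F) = n := by
  have h0 := hY.ne_zero
  have hded := isDedekindDomain_curveRing hy h0 h hf
  let φ : F →ₐ[ℂ] H := IsFractionRing.liftAlgHom (curveEmb_injective hy h0 h)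
  have hφ : ∀ r, φ (algebraMap (CurveRing f) F r) = curveEmb hy h0 h r := fun r =>
    IsFractionRing.lift_algebraMap (curveEmb_injective hy h0 h) r
  set x := algebraMap (CurveRing f) F (cX f) with hx
  set y := algebraMap (CurveRing f) F (cY f) with hy'
  have hφx : φ x = lam := (hφ _).trans (curveEmb_cX hy h0 h)
  have hφy : φ y = Y := (hφ _).trans (curveEmb_cY hy h0 h)
  have hy0 : y ≠ 0 := by
    intro hz
    rw [hz, map_zero] at hφy
    exact h0 hφy.symm
  have hsq : y ^ 2 = Polynomial.aeval x f := algebraMap_cY_sq f F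
  obtain ⟨L, hL, hL'⟩ := exists_residue φ
  have hLη : ∀ g : F, L (g • eta x y) = φ g * ((2 : ℂ) • (Y⁻¹ * lam)) := by
    intro g
    rw [hL', eta, hL', hL, hφx, theta_lam, map_inv₀, hφy, mul_smul_comm]
  -- The differential `dx/y` becomes `2λ/Y`, of order `2 - (2n+1)`.
  have hoL : HasOrder ((2 : ℂ) • (Y⁻¹ * lam)) (1 - 2 * n) := by
    have h1 := hY.inv.mul (hasOrder_zpow 2)
    have e : -(2 * n + 1 : ℤ) + 2 = 1 - 2 * n := by ring
    rw [e] at h1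
    refine ⟨?_, fun k hk => ?_⟩
    · rw [zcoeff_smul]
      exact mul_ne_zero two_ne_zero h1.1
    · rw [zcoeff_smul]
      exact mul_eq_zero_of_right _ (h1.2 k hk)
  have hη : eta x y ≠ 0 := by
    intro hz
    have h1 := hLη 1
    rw [hz, smul_zero, map_zero, map_one, one_mul] at h1
    exact hoL.ne_zero h1.symm
  have hli : LinearIndependent ℂ fun i : Fin n => x ^ (i : ℕ) • eta x y := by
    apply LinearIndependent.of_comp L
    refine linearIndependent_of_hasOrder (d := fun i : Fin n => 2 * (i : ℕ) + (1 - 2 * n)) ?_ ?_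
    · intro i j hij
      ext
      simp only at hij
      omega
    · intro i
      rw [Function.comp_apply, hLη, map_pow, hφx, lam_pow]
      exact (hasOrder_zpow _).mul hoL
  have hspan : regularDifferentials F =
      Submodule.span ℂ (Set.range fun i : Fin n => x ^ (i : ℕ) • eta x y) := by
    apply le_antisymm
    · intro ω hω
      obtain ⟨g, rfl⟩ := exists_eq_smul_eta hy0 ω
      obtain ⟨r, rfl⟩ := mem_range_of_regular hy0 hη hω
      have h1 := degLE_of_mem_span hL hL' hω
      obtain ⟨a, b, rfl⟩ := exists_eq_pair f r
      have hG : φ (algebraMap (CurveRing f) F (Polynomial.aeval (cX f) a +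
          Polynomial.aeval (cX f) b * cY f)) = Polynomial.aeval lam a + Polynomial.aeval lam b * Y :=
        (hφ _).trans (curveEmb_pair hy h0 h a b)
      rw [← hx, ← hy', hLη, hG] at h1
      -- Regularity at infinity bounds the image of `g dx/y` by order `-1`, hence `g` by `-1 -
      -- (1-2n) = 2n-2`. This leaves no room for a multiple of `Y` and bounds the polynomial part by
      -- degree `n-1`.
      have hdeg : DegLE (Polynomial.aeval lam a + Polynomial.aeval lam b * Y) (2 * n - 2) := by
        have h2 := h1.mul hoL.inv.degLE
        rw [mul_assoc, mul_inv_cancel₀ hoL.ne_zero, mul_one] at h2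
        exact h2.mono (by omega)
      have hodd := sigma_eq_neg_iff.mp (sigma_aeval_mul hy b)
      have ha : ∀ m : ℕ, n ≤ m → a.coeff m = 0 := by
        intro m hm
        have h2 := hdeg (2 * m) (by omega)
        rwa [zcoeff_add, hodd _ ⟨m, by ring⟩, add_zero, zcoeff_aeval_lam] at h2
      have hb : b = 0 := by
        by_contra hb0
        have h2 := (hasOrder_aeval_lam hb0).mul hY
        have h3 := hdeg (2 * b.natDegree + (2 * n + 1)) (by omega)
        rw [zcoeff_add, zcoeff_aeval_lam_eq_zero a (fun m => by omega), zero_add] at h3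
        exact h2.1 h3
      rw [hb, map_zero, zero_mul, add_zero, ← Polynomial.aeval_algebraMap_apply, ← hx,
        Polynomial.aeval_eq_sum_range x, Finset.sum_smul]
      refine Submodule.sum_mem _ fun i _ => ?_
      rw [smul_assoc]
      rcases lt_or_ge i n with hi | hi
      · exact Submodule.smul_mem _ _ (Submodule.subset_span ⟨⟨i, hi⟩, rfl⟩)
      · rw [ha i hi, zero_smul]
        exact Submodule.zero_mem _
    · rw [Submodule.span_le]
      rintro _ ⟨i, rfl⟩ A hA
      by_cases hxA : x ∈ A
      · exact pow_smul_eta_mem_of_mem hy0 hsq hf hA hxA i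
      · exact pow_smul_eta_mem_of_notMem hy0 hsq hm hd hA hxA i.2
  rw [hspan, rank_span hli, Cardinal.mk_range_eq _ hli.injective]
  simp

end Genus

/-- The space of regular differentials depends only on the function field; `e` makes that of `g` a
fraction field of the coordinate ring of `f`. -/
theorem curveHasGenus_of_equiv {n : ℕ} {f g : ℂ[X]} {Y : H} (hy : sigma Y = -Y)
    (hY : HasOrder Y (2 * n + 1)) (h : Y ^ 2 = Polynomial.aeval lam f) (hf : Squarefree f)
    (hm : f.Monic) (hd : f.natDegree = 2 * n + 1) (hg : IsDomain (CurveRing g))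
    (e : FractionRing (CurveRing f) ≃ₐ[ℂ] FractionRing (CurveRing g)) : CurveHasGenus g n := by
  refine ⟨hg, ?_⟩
  have hdom := isDomain_curveRing hy hY.ne_zero h
  let i : CurveRing f →ₐ[ℂ] FractionRing (CurveRing g) := e.toAlgHom.comp
    ((Algebra.ofId (CurveRing f) (FractionRing (CurveRing f))).restrictScalars ℂ)
  let _ : Algebra (CurveRing f) (FractionRing (CurveRing g)) := i.toRingHom.toAlgebra
  have hmap : ∀ r, algebraMap (CurveRing f) (FractionRing (CurveRing g)) r =
      e (algebraMap _ _ r) := fun _ => rfl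
  have : IsScalarTower ℂ (CurveRing f) (FractionRing (CurveRing g)) :=
    IsScalarTower.of_algebraMap_eq fun c => (i.commutes c).symm
  have : FaithfulSMul (CurveRing f) (FractionRing (CurveRing g)) := by
    rw [faithfulSMul_iff_algebraMap_injective]
    exact e.injective.comp (IsFractionRing.injective (CurveRing f) (FractionRing (CurveRing f)))
  have : IsFractionRing (CurveRing f) (FractionRing (CurveRing g)) := by
    refine IsFractionRing.of_field (CurveRing f) (FractionRing (CurveRing g)) fun z => ?_
    obtain ⟨r, s, hs, hrs⟩ := IsFractionRing.div_surjective (A := CurveRing f) (e.symm z)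
    refine ⟨r, s, ?_⟩
    rw [hmap, hmap, ← map_div₀, hrs, e.apply_symm_apply]
  exact rank_regularDifferentials hy hY h hf hm hd

/-! ### Existence and uniqueness -/

/-- Substitute `P - 1` into the binomial series `(1+t)^(1/2)`; exponents add, so the square is `1 +
(P-1)`. The sign is then adjusted to make the constant term `1`. -/
theorem exists_sq_eq_powerSeries (P : PowerSeries ℂ) (hP : PowerSeries.constantCoeff P = 1) :
    ∃ Q : PowerSeries ℂ, Q ^ 2 = P ∧ PowerSeries.constantCoeff Q = 1 := by
  have ha : PowerSeries.HasSubst (P - 1) := PowerSeries.HasSubst.of_constantCoeff_zero' (by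
    rw [map_sub, hP, map_one, sub_self])
  have hsq : (PowerSeries.subst (P - 1) (PowerSeries.binomialSeries ℂ (1 / 2 : ℂ))) ^ 2 = P := by
    rw [pow_two, ← PowerSeries.subst_mul ha, ← PowerSeries.binomialSeries_add, add_halves]
    have h1 := PowerSeries.binomialSeries_nat (R := ℂ) (A := ℂ) 1
    rw [Nat.cast_one, pow_one] at h1
    rw [h1, PowerSeries.subst_add ha, PowerSeries.subst_X ha, ← PowerSeries.coe_substAlgHom ha,
      map_one]
    ring
  set Q : PowerSeries ℂ := PowerSeries.subst (P - 1) (PowerSeries.binomialSeries ℂ (1 / 2 : ℂ))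
  have hc := congrArg PowerSeries.constantCoeff hsq
  rw [map_pow, hP, pow_two] at hc
  rcases mul_self_eq_one_iff.mp hc with h | h
  · exact ⟨Q, hsq, h⟩
  · exact ⟨-Q, by rw [neg_sq, hsq], by rw [map_neg, h, neg_neg]⟩

theorem exists_sqrt {n : ℕ} {f : ℂ[X]} (hm : f.Monic) (hd : f.natDegree = 2 * n + 1) :
    ∃ Y : H, Y ^ 2 = Polynomial.aeval lam f ∧ DegLE Y (2 * n + 1) ∧ zcoeff Y (2 * n + 1) = 1 := by
  have ho : HasOrder (Polynomial.aeval lam f) (2 * f.natDegree) := hasOrder_aeval_lam hm.ne_zero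
  have he := ho.degLE.eq_ofPS
  set P : PowerSeries ℂ :=
    PowerSeries.mk fun i => zcoeff (Polynomial.aeval lam f) (2 * f.natDegree - i) with hPdef
  have hP : PowerSeries.constantCoeff P = 1 := by
    rw [← PowerSeries.coeff_zero_eq_constantCoeff_apply, hPdef, PowerSeries.coeff_mk,
      Nat.cast_zero, sub_zero, zcoeff_aeval_lam]
    exact hm.coeff_natDegree
  obtain ⟨Q, hQ, hQ1⟩ := exists_sq_eq_powerSeries P hP
  refine ⟨zpow (2 * n + 1) * ofPS Q, ?_, ?_, ?_⟩
  · rw [he, mul_pow, ← map_pow, hQ, pow_two, zpow_mul_zpow, hd]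
    congr 2
    push_cast
    ring
  · intro k hk
    rw [zcoeff_zpow_mul, zcoeff_ofPS_of_pos _ (by omega)]
  · have := zcoeff_ofPS Q 0
    rw [PowerSeries.coeff_zero_eq_constantCoeff_apply, hQ1] at this
    rw [zcoeff_zpow_mul, sub_self]
    simpa using this

theorem sigma_sqrt {n : ℕ} {f : ℂ[X]} {Y : H} (h : Y ^ 2 = Polynomial.aeval lam f)
    (h1 : zcoeff Y (2 * n + 1) = 1) : sigma Y = -Y := by
  have hs : sigma Y * sigma Y = Y * Y := by
    rw [← map_mul, ← pow_two, h, sigma_aeval_lam]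
  rcases mul_self_eq_mul_self_iff.mp hs with h2 | h2
  · rw [zcoeff_odd_of_sigma_eq h2 ⟨n, rfl⟩] at h1
    exact absurd h1 zero_ne_one
  · exact h2

/-- Polynomials `α_m` for which `α_m(λ) Y` has no powers `z ^ k`, `2n+1 ≤ k < 2m+1`. -/
theorem exists_reduced_multiples {n : ℕ} {Y : H} (hy : sigma Y = -Y) (hY : DegLE Y (2 * n + 1))
    (h1 : zcoeff Y (2 * n + 1) = 1) (j : ℕ) : ∃ a : ℂ[X],
      ∀ k : ℤ, (Even k ∨ (2 * n + 1 : ℤ) ≤ k) → zcoeff (Polynomial.aeval lam a * Y) k =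
        if k = 2 * (n + j : ℕ) + 1 then 1 else 0 := by
  induction j using Nat.strong_induction_on with
  | _ j ih =>
    choose! a ha using ih
    -- Elimination: from `λ^j Y` subtract the earlier reduced multiples, weighted by its
    -- coefficients at the powers `2(n+i)+1`, `i < j`.
    refine ⟨Polynomial.X ^ j - ∑ i ∈ Finset.range j,
      Polynomial.C (zcoeff (lam ^ j * Y) (2 * (n + i : ℕ) + 1)) * a i, fun k hk => ?_⟩
    have e : Polynomial.aeval lam (Polynomial.X ^ j - ∑ i ∈ Finset.range j,
        Polynomial.C (zcoeff (lam ^ j * Y) (2 * (n + i : ℕ) + 1)) * a i) * Y = lam ^ j * Y -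
        ∑ i ∈ Finset.range j, zcoeff (lam ^ j * Y) (2 * (n + i : ℕ) + 1) •
          (Polynomial.aeval lam (a i) * Y) := by
      rw [map_sub, map_pow, Polynomial.aeval_X, map_sum, sub_mul, Finset.sum_mul]
      congr 1
      refine Finset.sum_congr rfl fun i _ => ?_
      rw [map_mul, Polynomial.aeval_C, Algebra.smul_def, mul_assoc]
    have e2 : zcoeff (∑ i ∈ Finset.range j, zcoeff (lam ^ j * Y) (2 * (n + i : ℕ) + 1) •
          (Polynomial.aeval lam (a i) * Y)) k = ∑ i ∈ Finset.range j,
            zcoeff (lam ^ j * Y) (2 * (n + i : ℕ) + 1) *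
              if k = 2 * (n + i : ℕ) + 1 then 1 else 0 := by
      rw [zcoeff_sum]
      refine Finset.sum_congr rfl fun i hi => ?_
      rw [zcoeff_smul, ha i (Finset.mem_range.mp hi) k hk]
    have hD : DegLE (lam ^ j * Y) (2 * (n + j : ℕ) + 1) := by
      rw [lam_pow]
      refine ((hasOrder_zpow _).degLE.mul hY).mono ?_
      push_cast
      omega
    rw [e, zcoeff_sub, e2]
    rcases Int.even_or_odd' k with ⟨m, rfl | rfl⟩
    · have hodd : zcoeff (lam ^ j * Y) (2 * m) = 0 := by
        refine sigma_eq_neg_iff.mp ?_ _ ⟨m, by ring⟩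
        rw [map_mul, map_pow, sigma_lam, hy, mul_neg]
      rw [hodd, if_neg (by omega), Finset.sum_eq_zero, sub_zero]
      intro i _
      rw [if_neg (by omega), mul_zero]
    · have hm : (n : ℤ) ≤ m := by
        rcases hk with hk | hk
        · exact absurd hk (Int.not_even_two_mul_add_one m)
        · omega
      obtain ⟨i, rfl⟩ : ∃ i : ℕ, m = (n + i : ℕ) := ⟨(m - n).toNat, by omega⟩
      rcases lt_trichotomy i j with hij | rfl | hij
      · rw [if_neg (by omega), Finset.sum_eq_single i]
        · rw [if_pos rfl, mul_one, sub_self]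
        · intro i' _ hne
          rw [if_neg (by omega), mul_zero]
        · exact fun hn => absurd (Finset.mem_range.mpr hij) hn
      · rw [if_pos rfl, Finset.sum_eq_zero, sub_zero, lam_pow, zcoeff_zpow_mul, ← h1]
        · congr 1
          push_cast
          ring
        · intro i' hi'
          rw [if_neg (by have := Finset.mem_range.mp hi'; omega), mul_zero]
      · rw [if_neg (by omega), Finset.sum_eq_zero, sub_zero]
        · exact hD _ (by omega)
        · intro i' hi'
          rw [if_neg (by have := Finset.mem_range.mp hi'; omega), mul_zero]

/-- Powers of `λ` and reduced multiples of a square root `Y` of `f` form a canonical family. By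
comparison of orders its span is all of `ℂ[λ] ⊕ ℂ[λ]Y`, which is closed under products because `Y² =
f(λ)`. -/
theorem exists_isMultCanonical {n : ℕ} {f : ℂ[X]} (hm : f.Monic) (hd : f.natDegree = 2 * n + 1) :
    ∃ p : ℕ → H, IsMultCanonical n p ∧ p (2 * n + 1) ^ 2 = Polynomial.aeval lam f := by
  obtain ⟨Y, hYf, hYd, hY1⟩ := exists_sqrt hm hd
  have hy := sigma_sqrt hYf hY1
  choose a ha using exists_reduced_multiples hy hYd hY1
  -- At the gaps the truncated subtraction gives index `0`; these values are never used.
  let p : ℕ → H := fun i => if Even i then lam ^ (i / 2) else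
    Polynomial.aeval lam (a ((i - 1) / 2 - n)) * Y
  have hpe : ∀ m, p (2 * m) = lam ^ m := fun m => by
    simp only [p, if_pos (even_two_mul m)]
    congr 1
    omega
  have hpo : ∀ m, p (2 * m + 1) = Polynomial.aeval lam (a (m - n)) * Y := fun m => by
    simp only [p, if_neg (Nat.not_even_two_mul_add_one m)]
    congr 4
    omega
  have hcan : IsCanonical n p := by
    have hp0 : p 0 = 1 := hpe 0
    refine ⟨?_, ?_, ?_, ?_, ?_⟩
    · rw [hp0, zcoeff_one, if_pos rfl]
    · intro k hk
      rw [hp0, zcoeff_one, if_neg (by omega)]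
    · intro m
      rw [hpe, hp0, mul_one, lam_pow]
    · intro m hm
      rw [hpo, ha _ _ (Or.inr (by omega)), if_pos (by omega)]
    · intro m hm k _ hk hk'
      rw [hpo, ha _ _ hk', if_neg (by omega)]
  have hYo : HasOrder Y (2 * n + 1) := ⟨by rw [hY1]; exact one_ne_zero, hYd⟩
  have ho : HasOrder (p (2 * n + 1)) (2 * n + 1) := by
    simpa using hcan.hasOrder (odd_mem_posOrders le_rfl)
  -- Equal orders make `a 0` a constant, and equal leading coefficients make it `1`.
  have hYp : p (2 * n + 1) = Y := by
    have hlead := hcan.odd_lead n le_rfl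
    rw [hpo, Nat.sub_self] at ho hlead
    have ha0 : a 0 ≠ 0 := by
      intro hz
      rw [hz, map_zero, zero_mul] at ho
      exact ho.ne_zero rfl
    have h2 := ((hasOrder_aeval_lam ha0).mul hYo).unique ho
    obtain ⟨c, hc⟩ := Polynomial.natDegree_eq_zero.mp (show (a 0).natDegree = 0 by omega)
    rw [← hc, Polynomial.aeval_C, ← Algebra.smul_def, zcoeff_smul, hY1, mul_one] at hlead
    rw [hpo, Nat.sub_self, ← hc, hlead, map_one, map_one, one_mul]
  have hle : wSpan n p ≤ LinearMap.range (pairMap lam Y) := by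
    rw [wSpan, Submodule.span_le]
    rintro _ ⟨i, hi, rfl⟩
    rcases mem_posOrders_iff.mp hi with ⟨m, rfl⟩ | ⟨m, hm, rfl⟩
    · refine ⟨(Polynomial.X ^ m, 0), ?_⟩
      rw [pairMap_apply, hpe, map_pow, Polynomial.aeval_X, map_zero, zero_mul, add_zero]
    · refine ⟨(0, a (m - n)), ?_⟩
      rw [pairMap_apply, hpo, map_zero, zero_add]
  -- Even and odd parts cannot cancel, so the order of `b(λ) + c(λ)Y` is that of one of the two
  -- summands.
  have hord : orders (LinearMap.range (pairMap lam Y)) ⊆ orders (wSpan n p) := by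
    rintro s ⟨_, ⟨⟨b, c⟩, rfl⟩, hs⟩
    rw [pairMap_apply] at hs
    have hodd := sigma_eq_neg_iff.mp (sigma_aeval_mul hy c)
    have hev : ∀ k : ℤ, Odd k → zcoeff (Polynomial.aeval lam b) k = 0 := fun k hk =>
      zcoeff_odd_of_sigma_eq (sigma_aeval_lam b) hk
    rcases Int.even_or_odd s with he | he
    · have h1 := hs.1
      rw [zcoeff_add, hodd s he, add_zero] at h1
      by_cases hm : ∃ m : ℕ, s = 2 * m
      · obtain ⟨m, rfl⟩ := hm
        exact_mod_cast hcan.mem_orders_wSpan.mpr (two_mul_mem_posOrders n m)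
      · push Not at hm
        exact absurd (zcoeff_aeval_lam_eq_zero b hm) h1
    · have h1 : HasOrder (Polynomial.aeval lam c * Y) s := by
        refine ⟨?_, fun k hk => ?_⟩
        · have := hs.1
          rwa [zcoeff_add, hev s he, zero_add] at this
        · rcases Int.even_or_odd k with hk' | hk'
          · exact hodd k hk'
          · have := hs.2 k hk
            rwa [zcoeff_add, hev k hk', zero_add] at this
      have hc0 : c ≠ 0 := by
        rintro rfl
        rw [map_zero, zero_mul] at h1
        exact h1.ne_zero rfl
      have h2 := h1.unique ((hasOrder_aeval_lam hc0).mul hYo)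
      have h3 : s = ((2 * (n + c.natDegree) + 1 : ℕ) : ℤ) := by omega
      rw [h3]
      exact hcan.mem_orders_wSpan.mpr (odd_mem_posOrders (by omega))
  have heq : wSpan n p = LinearMap.range (pairMap lam Y) :=
    le_antisymm hle (le_of_orders_subset hle hord fun s hs => hcan.nonneg_of_mem_orders (hord hs))
  refine ⟨p, ⟨hcan, fun i hi j hj => ?_⟩, by rw [hYp, hYf]⟩
  have hpair : ∀ i ∈ posOrders n, p i ∈ pairSubalgebra lam Y f hYf := fun i hi => by
    obtain ⟨⟨b, c⟩, hbc⟩ := hle (Submodule.subset_span ⟨i, hi, rfl⟩)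
    exact ⟨b, c, by rw [← hbc, pairMap_apply]⟩
  obtain ⟨b, c, hbc⟩ := mul_mem (hpair i hi) (hpair j hj)
  rw [heq]
  exact ⟨(b, c), by rw [hbc, pairMap_apply]⟩

theorem IsMultCanonical.base_unique {n : ℕ} {p p' : ℕ → H} (hp : IsMultCanonical n p)
    (hp' : IsMultCanonical n p') (h : p (2 * n + 1) ^ 2 = p' (2 * n + 1) ^ 2) :
    p (2 * n + 1) = p' (2 * n + 1) := by
  rw [pow_two, pow_two] at h
  rcases mul_self_eq_mul_self_iff.mp h with h1 | h1
  · exact h1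
  · exfalso
    have h2 := hp.1.odd_lead n le_rfl
    rw [h1, zcoeff_neg, hp'.1.odd_lead n le_rfl] at h2
    norm_num at h2

end BirkhoffGr

end

theorem mainTheorem8 (n : ℕ) :
    -- `u_m` are universal polynomials in the `H^{2n+1}_{2k+1}`, `k = j - n ≥ -n`
    (∃ U : Fin (2 * n + 1) → MvPolynomial ℕ ℂ,
      ∀ p : ℕ → BirkhoffGr.H, BirkhoffGr.IsMultCanonical n p →
      ∀ W : Submodule ℂ BirkhoffGr.H, W = BirkhoffGr.wSpan n p →
      ∀ u : Fin (2 * n + 1) → ℂ,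
        (∀ m, u m = MvPolynomial.eval
          (fun j : ℕ => BirkhoffGr.zcoeff (p (2 * n + 1)) (2 * (n : ℤ) - 1 - 2 * j)) (U m)) →
      ∀ f : Polynomial ℂ, f = BirkhoffGr.basePoly n u →
        -- `W` is the positive-order part of a point of the stratum
        (∃ V ∈ BirkhoffGr.stratum2 n, W ≤ V ∧ V = W ⊔ (V ⊓ BirkhoffGr.Hminus)) ∧
        -- `W` has the basis `λ ^ m`, `p_{2n+1}`, `p_{2n+3}`, …
        (∀ m : ℕ, p (2 * m) = BirkhoffGr.lam ^ m) ∧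
        LinearIndependent ℂ (fun i : BirkhoffGr.posOrders n => p i) ∧
        -- `W` is an algebra, isomorphic to `ℂ[λ, p_{2n+1}] / (p_{2n+1} ^ 2 - f(λ))`
        (∃ A : Subalgebra ℂ BirkhoffGr.H, Subalgebra.toSubmodule A = W ∧
          ∃ e : BirkhoffGr.CurveRing f ≃ₐ[ℂ] A,
            (e (Ideal.Quotient.mk _ (MvPolynomial.X 0)) : BirkhoffGr.H) = BirkhoffGr.lam ∧
            (e (Ideal.Quotient.mk _ (MvPolynomial.X 1)) : BirkhoffGr.H) = p (2 * n + 1)) ∧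
        -- the tower of curves
        (∃ α : ℕ → Polynomial ℂ,
          (∀ m : ℕ, n + 1 ≤ m → (α m).Monic ∧ (α m).natDegree = m - n ∧
            p (2 * m + 1) = Polynomial.aeval BirkhoffGr.lam (α m) * p (2 * n + 1)) ∧
          RingHom.ker (MvPolynomial.aeval (R := ℂ) (BirkhoffGr.towerPoint n p)) =
            BirkhoffGr.towerIdeal n f α ∧
          (∀ l : ℕ, n + 1 ≤ l →
            p (2 * l + 1) ^ 2 = Polynomial.aeval BirkhoffGr.lam (α l ^ 2 * f) ∧
            (α l ^ 2 * f).natDegree = 2 * l + 1 ∧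
            RingHom.ker (MvPolynomial.aeval (R := ℂ) ![BirkhoffGr.lam, p (2 * l + 1)]) =
              Ideal.span {BirkhoffGr.curveEq (α l ^ 2 * f)} ∧
            IsDomain (BirkhoffGr.CurveRing (α l ^ 2 * f)) ∧
            Nonempty (FractionRing (BirkhoffGr.CurveRing f) ≃ₐ[ℂ]
              FractionRing (BirkhoffGr.CurveRing (α l ^ 2 * f)))) ∧
          -- when the base curve is nonsingular, it and all curves of the tower have genus `n`
          (Squarefree f → BirkhoffGr.CurveHasGenus f n ∧
            ∀ l : ℕ, n + 1 ≤ l → BirkhoffGr.CurveHasGenus (α l ^ 2 * f) n)) ∧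
        -- codimension
        BirkhoffGr.codim W = n ∧
        Module.rank ℂ
          ((BirkhoffGr.H ⧸ BirkhoffGr.Hminus) ⧸
            LinearMap.range (BirkhoffGr.projPlus W)) = n ∧
        -- index
        FiniteDimensional ℂ (BirkhoffGr.dbarKer W) ∧
        FiniteDimensional ℂ (BirkhoffGr.dbarCoker W) ∧
        BirkhoffGr.dbarIndex W = -(n : ℤ) ∧
        (BirkhoffGr.orders W \ BirkhoffGr.natInt).Finite ∧
        (BirkhoffGr.orders (BirkhoffGr.dualSpace W) \ BirkhoffGr.natInt).Finite ∧
        ((BirkhoffGr.orders W \ BirkhoffGr.natInt).ncard : ℤ) -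
          ((BirkhoffGr.orders (BirkhoffGr.dualSpace W) \ BirkhoffGr.natInt).ncard : ℤ) =
            -(n : ℤ)) ∧
    -- every monic polynomial of degree `2n+1` occurs for exactly one member of the family
    (∀ u : Fin (2 * n + 1) → ℂ, ∃! W : Submodule ℂ BirkhoffGr.H, W ∈ BirkhoffGr.W2 n ∧
      ∃ p : ℕ → BirkhoffGr.H, BirkhoffGr.IsMultCanonical n p ∧ W = BirkhoffGr.wSpan n p ∧
        p (2 * n + 1) ^ 2 = Polynomial.aeval BirkhoffGr.lam (BirkhoffGr.basePoly n u)) := by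
  refine ⟨⟨BirkhoffGr.squarePoly n, ?_⟩, ?_⟩
  · rintro p hp W rfl u hu f rfl
    have hf := hp.base_sq u hu
    have hy := hp.sigma_base
    have ho := hp.hasOrder_base
    have h0 := ho.ne_zero
    have hm := BirkhoffGr.basePoly_monic n u
    have hd := BirkhoffGr.basePoly_natDegree n u
    set f := BirkhoffGr.basePoly n u with hfdef
    have hα : ∀ m : ℕ, ∃ b : ℂ[X], n ≤ m → b.Monic ∧ b.natDegree = m - n ∧
        p (2 * m + 1) = Polynomial.aeval BirkhoffGr.lam b * p (2 * n + 1) := fun m => by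
      by_cases hnm : n ≤ m
      · obtain ⟨b, hb⟩ := hp.exists_alpha hnm
        exact ⟨b, fun _ => hb⟩
      · exact ⟨0, fun h => absurd h hnm⟩
    choose α hα using hα
    have hker : BirkhoffGr.dbarKer (BirkhoffGr.wSpan n p) = ⊥ := hp.1.wSpan_inf_Hminus
    have hlevel : ∀ l : ℕ, n + 1 ≤ l →
        p (2 * l + 1) ^ 2 = Polynomial.aeval BirkhoffGr.lam (α l ^ 2 * f) ∧
        BirkhoffGr.sigma (p (2 * l + 1)) = -p (2 * l + 1) ∧ p (2 * l + 1) ≠ 0 := by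
      intro l hl
      obtain ⟨hb, -, hpl⟩ := hα l (by omega)
      refine ⟨?_, ?_, ?_⟩
      · rw [hpl, mul_pow, hf, map_mul, map_pow]
      · rw [hpl]
        exact BirkhoffGr.sigma_aeval_mul hy _
      · rw [hpl]
        exact mul_ne_zero (BirkhoffGr.hasOrder_aeval_lam hb.ne_zero).ne_zero h0
    refine ⟨hp.exists_stratum, hp.even_eq_lam_pow, hp.1.linearIndependent,
      ⟨_, hp.toSubmodule_range hf, BirkhoffGr.curveEquiv hy h0 hf,
        BirkhoffGr.curveEmb_cX hy h0 hf, BirkhoffGr.curveEmb_cY hy h0 hf⟩,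
      ⟨α, fun m hm => hα m (by omega), hp.ker_towerPoint hf fun m hm => (hα m (by omega)).2.2,
        ?_, ?_⟩, hp.1.codim_wSpan, hp.1.rank_quotient_range_projPlus, ?_,
      hp.finiteDimensional_dbarCoker, ?_, ?_, ?_, ?_⟩
    · intro l hl
      obtain ⟨hsq, hyl, hl0⟩ := hlevel l hl
      obtain ⟨hb, hbd, -⟩ := hα l (by omega)
      refine ⟨hsq, ?_, BirkhoffGr.curve_ker hyl hl0 hsq, BirkhoffGr.isDomain_curveRing hyl hl0 hsq,
        BirkhoffGr.functionField_equiv hy h0 hf hb.ne_zero⟩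
      rw [(hb.pow 2).natDegree_mul hm, hb.natDegree_pow, hbd, hd]
      omega
    · intro hsf
      refine ⟨BirkhoffGr.curveHasGenus_of_equiv hy ho hf hsf hm hd
        (BirkhoffGr.isDomain_curveRing hy h0 hf) AlgEquiv.refl, fun l hl => ?_⟩
      obtain ⟨hsq, hyl, hl0⟩ := hlevel l hl
      obtain ⟨e⟩ := BirkhoffGr.functionField_equiv hy h0 hf (hα l (by omega)).1.ne_zero
      exact BirkhoffGr.curveHasGenus_of_equiv hy ho hf hsf hm hd
        (BirkhoffGr.isDomain_curveRing hyl hl0 hsq) e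
    · rw [hker]
      infer_instance
    · rw [BirkhoffGr.dbarIndex, hker, hp.finrank_dbarCoker, finrank_bot]
      simp
    · rw [hp.orders_diff_natInt]
      exact Set.finite_empty
    · rw [hp.orders_dual_diff_natInt]
      exact Set.finite_range _
    · rw [hp.orders_diff_natInt, hp.orders_dual_diff_natInt, Set.ncard_empty, ← Set.image_univ,
        Set.ncard_image_of_injective _ (BirkhoffGr.IsMultCanonical.neg_gap_injective n), Set.ncard_univ]
      simp
  · intro u
    obtain ⟨p, hp, hpu⟩ := BirkhoffGr.exists_isMultCanonical (BirkhoffGr.basePoly_monic n u)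
      (BirkhoffGr.basePoly_natDegree n u)
    refine ⟨_, ⟨⟨p, hp, rfl⟩, p, hp, rfl, hpu⟩, ?_⟩
    rintro _ ⟨-, p', hp', rfl, hpu'⟩
    -- `W` is determined by its base series, which is fixed by its square and its leading
    -- coefficient.
    rw [hp.wSpan_eq_range, hp'.wSpan_eq_range, hp.base_unique hp' (hpu.trans hpu'.symm)]
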